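/- Let $\mathcal F$ be a skew field, $n\ge 1$, $G=GL_n(\mathcal F)$; let $H$ be the subgroup of diagonal matrices, $B$, $B^-$ the subgroups of upper and lower triangular matrices, and $U$, $U^-$ the subgroups of upper and lower unitriangular matrices. An element $x$ of $G_0=U^-HU$ is written uniquely as $x=ldp$ with $l\in U^-$, $d\in H$, $p\in U$; put $[x]_-=ld$, $[x]_0=d$, $[x]_+=p$. For $1\le i<n$ let $\varphi_i:GL_2(\mathcal F)\to G$ be the embedding as the block in rows and columns $i,i+1$, let $s_i=(i,i+1)\in S_n$, and for $t\in\mathcal F^\times$ put $x_i(t)=\varphi_i\begin{pmatrix}1&t\\0&1\end{pmatrix}$, $x_{-i}(t)=\varphi_i\begin{pmatrix}t^{-1}&0\\1&t\end{pmatrix}$. Permutations are identified with permutation matrices ($we_j=e_{w(j)}$), $\ell(w)$ is the number of inversions of $w\in S_n$, and $\overline w\in G$ is the representative of $w$ determined by $\overline{s_i}=\varphi_i\begin{pmatrix}0&-1\\1&0\end{pmatrix}$ and $\overline{uv}=\overline u\,\overline v$ whenever $\ell(uv)=\ell(u)+\ell(v)$. Let $x^\iota=J x^{-1}J$ with $J=\mathrm{diag}(-1,1,-1,\dots,(-1)^n)$.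 For a matrix $A$, the quasideterminant $|A|_{ij}=a_{ij}-r_i(A^{ij})^{-1}c_j$ is defined when $A^{ij}$ ($A$ without row $i$ and column $j$) is invertible; here $r_i$ and $c_j$ are row $i$ and column $j$ of $A$ without the entry $a_{ij}$. For $u,v\in S_n$ and $k\in[1,n]$ put $I=u\{1,\dots,k\}$, $J'=v\{1,\dots,k\}$, and $$\Delta^k_{u,v}(x)=(-1)^{d}\,|x_{I,J'}|_{u(k),v(k)},$$ where $d$ is the number of elements of $I$ greater than $u(k)$ plus the number of elements of $J'$ greater than $v(k)$. For $u,v\in S_n$ let $G^{u,v}=BuB\cap B^-vB^-$ and $L^{u,v}=U\overline uU\cap B^-vB^-$. Define $\psi^{u,v}(x)=([x\,\overline{v^{-1}}]_-)^\iota\,(x^\iota)^{-1}\,([\overline u^{\,-1}x]_+)^\iota$ for $x\in L^{u,v}$, and extend it to $G^{u,v}$ by $\psi^{u,v}(hx)=h\,\psi^{u,v}(x)$ for $h\in H$, $x\in L^{u,v}$. **Theorem.** (1) For $g\in G^{u,v}$ one has $\overline u^{\,-1}g\in G_0$ and $g\,\overline{v^{-1}}\in G_0$, and multiplication is a bijection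 $H\times L^{u,v}\to G^{u,v}$; so $\psi^{u,v}$ is well defined on $G^{u,v}$. It is left $H$-equivariant and is given by $$\psi^{u,v}(g)=\bigl(\overline u\,[\overline u^{\,-1}g]_0\,\overline u^{\,-1}\bigr)\,([g\,\overline{v^{-1}}]_-)^\iota\,(g^\iota)^{-1}\,([\overline u^{\,-1}g]_+)^\iota .$$ It is a bijection $G^{u,v}\to G^{v,u}$ with inverse $\psi^{v,u}$. (2) Let $\mathbf i=(i_1,\dots,i_m)$ be a double reduced word for $(u,v)$, i.e. a sequence in $\{\pm1,\dots,\pm(n-1)\}$ such that the negatives of its negative letters form a reduced word for $u$ and its positive letters form a reduced word for $v$, in the given order. Suppose that $x\in G^{u,v}$ is factored as $x=h\,x_{i_1}(t_1)\cdots x_{i_m}(t_m)$ with $h=\mathrm{diag}(h_1,\dots,h_n)\in H$ and all $t_k\in\mathcal F^\times$. With the convention $s_{-i}=1$ for $i\in[1,n-1]$, put $$u_{\ge k}=s_{-i_m}\cdots s_{-i_k},\quad u_{>k}=s_{-i_m}\cdots s_{-i_{k+1}},\quad v_{\le k}=s_{i_1}\cdots s_{i_k},\quad v_{<k}=s_{i_1}\cdots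 s_{i_{k-1}}.$$ Then, with $y=\psi^{u,v}(x)$ and $i=|i_k|$, $$h_j=\Delta^{u^{-1}(j)}_{u,e}(x)\qquad(j\in[1,n]),$$ $$t_k=\begin{cases}\Delta^i_{v_{<k},u_{>k}}(y)^{-1}\Delta^i_{v_{<k},u_{\ge k}}(y)=\Delta^{i+1}_{v_{<k},u_{\ge k}}(y)^{-1}\Delta^{i+1}_{v_{<k},u_{>k}}(y)&\text{if }i_k<0,\\[1mm]\Delta^i_{v_{\le k},u_{>k}}(y)^{-1}\Delta^{i+1}_{v_{<k},u_{>k}}(y)=\Delta^i_{v_{<k},u_{>k}}(y)^{-1}\Delta^{i+1}_{v_{\le k},u_{>k}}(y)&\text{if }i_k>0\end{cases}$$ for $k\in[1,m]$; in particular all quasiminors that occur here are defined, and those that are inverted are nonzero. -/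

import Mathlib

open scoped Matrix

namespace DoubleBruhat

/-! ### Quasideterminants and positive quasiminors -/

section Quasi

variable {R : Type*} [Ring R] {m n : Type*} [Fintype m] [Fintype n] [DecidableEq m]
  [DecidableEq n]

/-- `N` is a two-sided inverse of `M` (rows and columns of `M` may be indexed by different
finite sets). -/
def IsInverse (M : Matrix m n R) (N : Matrix n m R) : Prop :=
  M * N = 1 ∧ N * M = 1

theorem IsInverse.unique {M : Matrix m n R} {N N' : Matrix n m R}
    (h : IsInverse M N) (h' : IsInverse M N') : N = N' := by
  calc N = N * (M * N') := by rw [h'.1, Matrix.mul_one]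
    _ = N' := by rw [← Matrix.mul_assoc, h.2, Matrix.one_mul]

open Classical in
/-- The two-sided inverse of `M` if there is one, and `0` otherwise. -/
noncomputable def inverse (M : Matrix m n R) : Matrix n m R :=
  if h : ∃ N, IsInverse M N then h.choose else 0

/-- The submatrix `A^{ij}` obtained by deleting row `i` and column `j`. -/
def deleteRowCol (A : Matrix m n R) (i : m) (j : n) :
    Matrix {p : m // p ≠ i} {q : n // q ≠ j} R :=
  A.submatrix Subtype.val Subtype.val

/-- The quasideterminant `|A|_{ij}` is defined iff `A^{ij}` is invertible. -/
def QuasidetDefined (A : Matrix m n R) (i : m) (j : n) : Prop :=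
  ∃ N, IsInverse (deleteRowCol A i j) N

/-- The quasideterminant `|A|_{ij} = a_{ij} - r_i (A^{ij})⁻¹ c_j`, where `r_i` is row `i` without
its entry `a_{ij}` and `c_j` is column `j` without its entry `a_{ij}`.
It is meaningful when `QuasidetDefined A i j` holds. -/
noncomputable def quasidet (A : Matrix m n R) (i : m) (j : n) : R :=
  A i j - (fun q : {q : n // q ≠ j} => A i q) ⬝ᵥ
    (inverse (deleteRowCol A i j) *ᵥ fun p : {p : m // p ≠ i} => A p j)

end Quasi

section Minors

variable {R : Type*} [Ring R] {N : ℕ}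

/-- The submatrix `x_{I,J}`. -/
def subMat (x : Matrix (Fin N) (Fin N) R) (I J : Finset (Fin N)) : Matrix I J R :=
  x.submatrix Subtype.val Subtype.val

/-- The positive quasiminor `Δ^{i,j}_{I,J}(x) = (-1)^{d_i(I)+d_j(J)} |x_{I,J}|_{ij}`, where
`d_i(I)` is the number of elements of `I` greater than `i`. -/
noncomputable def posQuasiminor (I J : Finset (Fin N)) (i : I) (j : J)
    (x : Matrix (Fin N) (Fin N) R) : R :=
  (-1) ^ ((I.filter fun a => i.1 < a).card + (J.filter fun b => j.1 < b).card) *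
    quasidet (subMat x I J) i j

/-- The set `w{1,…,k}`. Indices are zero-based throughout: `k : Fin N` stands for the index
`k + 1` of the usual one-based notation. -/
def initialImage (w : Equiv.Perm (Fin N)) (k : Fin N) : Finset (Fin N) :=
  (Finset.Iic k).map w.toEmbedding

/-- The element `w(k)` of `w{1,…,k}`. -/
def lastElt (w : Equiv.Perm (Fin N)) (k : Fin N) : initialImage w k :=
  ⟨w k, by simp [initialImage]⟩

/-- `Δ^k_{u,v} = Δ^{u(k),v(k)}_{u{1,…,k},v{1,…,k}}`. -/
noncomputable def Delta (k : Fin N) (u v : Equiv.Perm (Fin N))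
    (x : Matrix (Fin N) (Fin N) R) : R :=
  posQuasiminor (initialImage u k) (initialImage v k) (lastElt u k) (lastElt v k) x

/-- The quasideterminant in the definition of `Δ^k_{u,v}(x)` is defined. -/
def DeltaDefined (k : Fin N) (u v : Equiv.Perm (Fin N)) (x : Matrix (Fin N) (Fin N) R) : Prop :=
  QuasidetDefined (subMat x (initialImage u k) (initialImage v k)) (lastElt u k) (lastElt v k)

end Minors

/-! ### Permutations, lengths and reduced words -/

section Perms

variable {N r : ℕ}

/-- The set of inversions of `w`. -/
def inversions (w : Equiv.Perm (Fin N)) : Finset (Fin N × Fin N) :=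
  Finset.univ.filter fun p => p.1 < p.2 ∧ w p.2 < w p.1

/-- The length of `w`, i.e. its number of inversions. -/
def length (w : Equiv.Perm (Fin N)) : ℕ := (inversions w).card

/-- The simple transposition `s_i = (i, i+1)` in `S_{r+1}`, with `i : Fin r` zero-based. -/
def simpleRefl (i : Fin r) : Equiv.Perm (Fin (r + 1)) := Equiv.swap i.castSucc i.succ

/-- `(i_1, …, i_l)` is a reduced word for `w`. -/
def IsReducedWord (l : List (Fin r)) (w : Equiv.Perm (Fin (r + 1))) : Prop :=
  (l.map simpleRefl).prod = w ∧ l.length = length w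

/-- The alphabet `[-r,-1] ∪ [1,r]`: `neg i` is the letter `-i` and `pos i` is the letter `i`. -/
inductive Letter (r : ℕ)
  | neg (i : Fin r) : Letter r
  | pos (i : Fin r) : Letter r

/-- `i` if the letter is `-i`, nothing otherwise. -/
def Letter.neg? : Letter r → Option (Fin r)
  | .neg i => some i
  | .pos _ => none

/-- `i` if the letter is `i > 0`, nothing otherwise. -/
def Letter.pos? : Letter r → Option (Fin r)
  | .neg _ => none
  | .pos i => some i

/-- The reflection `s_{-a}` attached to a letter `a`, with `s_{-i} = 1` for `i > 0`:
it is `s_i` if `a = -i`, and `1` if `a` is positive. -/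
def Letter.reflNeg : Letter r → Equiv.Perm (Fin (r + 1))
  | .neg i => simpleRefl i
  | .pos _ => 1

/-- The reflection `s_a` attached to a letter `a`, with `s_{-i} = 1` for `i > 0`:
it is `s_i` if `a = i > 0`, and `1` if `a` is negative. -/
def Letter.reflPos : Letter r → Equiv.Perm (Fin (r + 1))
  | .neg _ => 1
  | .pos i => simpleRefl i

/-- `w` is a double reduced word for `(u,v)`: a shuffle of a reduced word for `u`, written in
negative letters, and a reduced word for `v`, written in positive letters. -/
def IsDoubleReducedWord (w : List (Letter r)) (u v : Equiv.Perm (Fin (r + 1))) : Prop :=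
  IsReducedWord (w.filterMap Letter.neg?) u ∧ IsReducedWord (w.filterMap Letter.pos?) v

/-- The partial product `s_{-i_m} s_{-i_{m-1}} ⋯ s_{-i_{a+1}}` (one-based letters), i.e. the
first `a` letters are dropped. -/
def uTail (w : List (Letter r)) (a : ℕ) : Equiv.Perm (Fin (r + 1)) :=
  ((w.drop a).reverse.map Letter.reflNeg).prod

/-- The partial product `s_{i_1} s_{i_2} ⋯ s_{i_a}` over the first `a` letters. -/
def vHead (w : List (Letter r)) (a : ℕ) : Equiv.Perm (Fin (r + 1)) :=
  ((w.take a).map Letter.reflPos).prod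

/-- `u_{≥ k} = s_{-i_m} ⋯ s_{-i_k}`. -/
def uGe {m : ℕ} (w : Fin m → Letter r) (k : Fin m) : Equiv.Perm (Fin (r + 1)) :=
  uTail (List.ofFn w) k

/-- `u_{> k} = s_{-i_m} ⋯ s_{-i_{k+1}}`. -/
def uGt {m : ℕ} (w : Fin m → Letter r) (k : Fin m) : Equiv.Perm (Fin (r + 1)) :=
  uTail (List.ofFn w) (k + 1)

/-- `v_{< k} = s_{i_1} ⋯ s_{i_{k-1}}`. -/
def vLt {m : ℕ} (w : Fin m → Letter r) (k : Fin m) : Equiv.Perm (Fin (r + 1)) :=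
  vHead (List.ofFn w) k

/-- `v_{≤ k} = s_{i_1} ⋯ s_{i_k}`. -/
def vLe {m : ℕ} (w : Fin m → Letter r) (k : Fin m) : Equiv.Perm (Fin (r + 1)) :=
  vHead (List.ofFn w) (k + 1)

end Perms

/-! ### The group `GL_{r+1}(F)` over a skew field -/

section Group

variable {F : Type*} [DivisionRing F] {r : ℕ}

/-- The group `G = GL_n(F)`, `n = r + 1`. -/
abbrev G (F : Type*) [DivisionRing F] (r : ℕ) : Type _ :=
  Matrix.GeneralLinearGroup (Fin (r + 1)) F

/-- The set `B` of upper triangular matrices in `G`. -/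
def B (F : Type*) [DivisionRing F] (r : ℕ) : Set (G F r) :=
  {g | ∀ i j, j < i → g.val i j = 0}

/-- The set `B⁻` of lower triangular matrices in `G`. -/
def Bminus (F : Type*) [DivisionRing F] (r : ℕ) : Set (G F r) :=
  {g | ∀ i j, i < j → g.val i j = 0}

/-- The set `H` of diagonal matrices in `G`. -/
def H (F : Type*) [DivisionRing F] (r : ℕ) : Set (G F r) :=
  {g | ∀ i j, i ≠ j → g.val i j = 0}

/-- The set `U` of upper unitriangular matrices. -/
def U (F : Type*) [DivisionRing F] (r : ℕ) : Set (G F r) :=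
  {g | (∀ i j, j < i → g.val i j = 0) ∧ ∀ i, g.val i i = 1}

/-- The set `U⁻` of lower unitriangular matrices. -/
def Uminus (F : Type*) [DivisionRing F] (r : ℕ) : Set (G F r) :=
  {g | (∀ i j, i < j → g.val i j = 0) ∧ ∀ i, g.val i i = 1}

/-- The diagonal matrix `diag(h_1, …, h_n)`. -/
def diag (h : Fin (r + 1) → Fˣ) : G F r where
  val := Matrix.diagonal fun i => (h i : F)
  inv := Matrix.diagonal fun i => ((h i)⁻¹ : Fˣ).val
  val_inv := by simp
  inv_val := by simp

/-- The matrix obtained from the identity by placing `A` in rows and columns `i, i+1`. -/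
def phiMat (i : Fin r) (A : Matrix (Fin 2) (Fin 2) F) : Matrix (Fin (r + 1)) (Fin (r + 1)) F :=
  Matrix.of fun a b =>
    if a = i.castSucc then
      if b = i.castSucc then A 0 0 else if b = i.succ then A 0 1 else 0
    else if a = i.succ then
      if b = i.castSucc then A 1 0 else if b = i.succ then A 1 1 else 0
    else if a = b then 1 else 0

theorem phiMat_one (i : Fin r) : phiMat i (1 : Matrix (Fin 2) (Fin 2) F) = 1 := by
  have hne : i.castSucc ≠ i.succ := (Fin.castSucc_lt_succ).ne
  ext a b
  by_cases ha : a = i.castSucc <;> by_cases ha' : a = i.succ <;>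
    by_cases hb : b = i.castSucc <;> by_cases hb' : b = i.succ <;>
    simp_all [phiMat, Matrix.one_apply, eq_comm]

theorem phiMat_mul (i : Fin r) (A A' : Matrix (Fin 2) (Fin 2) F) :
    phiMat i (A * A') = phiMat i A * phiMat i A' := by
  have hne : i.castSucc ≠ i.succ := (Fin.castSucc_lt_succ).ne
  ext a b
  rw [Matrix.mul_apply]
  by_cases ha : a = i.castSucc
  · rw [Finset.sum_eq_add_of_mem i.castSucc i.succ (Finset.mem_univ _) (Finset.mem_univ _) hne]
    · by_cases hb : b = i.castSucc <;> by_cases hb' : b = i.succ <;>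
        simp_all [phiMat, Matrix.mul_apply, Fin.sum_univ_two, Ne.symm hne]
    · rintro c - ⟨h1, h2⟩
      simp [phiMat, ha, h1, h2]
  · by_cases ha' : a = i.succ
    · rw [Finset.sum_eq_add_of_mem i.castSucc i.succ (Finset.mem_univ _) (Finset.mem_univ _) hne]
      · by_cases hb : b = i.castSucc <;> by_cases hb' : b = i.succ <;>
          simp_all [phiMat, Matrix.mul_apply, Fin.sum_univ_two, Ne.symm hne]
      · rintro c - ⟨h1, h2⟩
        simp [phiMat, ha', h1, h2, Ne.symm hne]
    · rw [Finset.sum_eq_single a]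
      · simp [phiMat, ha, ha']
      · intro c _ hc
        simp [phiMat, ha, ha', Ne.symm hc]
      · simp

/-- The embedding `φ_i : GL_2(F) → GL_n(F)`. -/
def phi (i : Fin r) : Matrix.GeneralLinearGroup (Fin 2) F →* G F r :=
  Units.map
    { toFun := phiMat i
      map_one' := phiMat_one i
      map_mul' := phiMat_mul i }

/-- `x_i(t) = φ_i (1 t; 0 1)`. -/
def xPos (i : Fin r) (t : Fˣ) : G F r :=
  phi i
    { val := !![1, (t : F); 0, 1]
      inv := !![1, -(t : F); 0, 1]
      val_inv := by ext a b; fin_cases a <;> fin_cases b <;> simp [Matrix.mul_apply]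
      inv_val := by ext a b; fin_cases a <;> fin_cases b <;> simp [Matrix.mul_apply] }

/-- `x_{-i}(t) = φ_i (t⁻¹ 0; 1 t)`. -/
def xNeg (i : Fin r) (t : Fˣ) : G F r :=
  phi i
    { val := !![(t : F)⁻¹, 0; 1, (t : F)]
      inv := !![(t : F), 0; -1, (t : F)⁻¹]
      val_inv := by ext a b; fin_cases a <;> fin_cases b <;> simp [Matrix.mul_apply]
      inv_val := by ext a b; fin_cases a <;> fin_cases b <;> simp [Matrix.mul_apply] }

/-- `x_a(t)` for a letter `a`. -/
def Letter.elt : Letter r → Fˣ → G F r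
  | .neg i, t => xNeg i t
  | .pos i, t => xPos i t

/-- The product map `x_{i_1}(t_1) ⋯ x_{i_m}(t_m)`. -/
def productMap {m : ℕ} (w : Fin m → Letter r) (t : Fin m → Fˣ) : G F r :=
  (List.ofFn fun k => (w k).elt (t k)).prod

/-- The permutation matrix of `w`, with `w e_j = e_{w(j)}`. -/
def permElt (F : Type*) [DivisionRing F] (w : Equiv.Perm (Fin (r + 1))) : G F r where
  val := Matrix.of fun a b => if a = w b then 1 else 0
  inv := Matrix.of fun a b => if b = w a then 1 else 0
  val_inv := by
    ext a b
    rw [Matrix.mul_apply, Finset.sum_eq_single (w⁻¹ a)]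
    · simp [Matrix.one_apply, eq_comm]
    · intro c _ hc
      have hc' : a ≠ w c := fun h => hc (by simp [h])
      simp [hc']
    · simp
  inv_val := by
    ext a b
    rw [Matrix.mul_apply, Finset.sum_eq_single (w a)]
    · simp [Matrix.one_apply]
    · intro c _ hc
      simp [hc]
    · simp

/-- The element `φ_i (0 -1; 1 0)`, the chosen representative of `s_i`. -/
def sBar (F : Type*) [DivisionRing F] (i : Fin r) : G F r :=
  phi i
    { val := !![0, -1; 1, 0]
      inv := !![0, 1; -1, 0]
      val_inv := by ext a b; fin_cases a <;> fin_cases b <;> simp [Matrix.mul_apply]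
      inv_val := by ext a b; fin_cases a <;> fin_cases b <;> simp [Matrix.mul_apply] }

/-- The sign `(-1)^{#{k < j : w(k) > w(j)}}`. -/
def barSign (F : Type*) [DivisionRing F] (w : Equiv.Perm (Fin (r + 1))) (j : Fin (r + 1)) : F :=
  (-1) ^ (Finset.univ.filter fun k => k < j ∧ w j < w k).card

theorem barSign_mul_self (w : Equiv.Perm (Fin (r + 1))) (j : Fin (r + 1)) :
    barSign F w j * barSign F w j = 1 := by
  rw [barSign, ← pow_add, ← two_mul, pow_mul]; simp

/-- The representative `w̄` of `w` in `G`, as an explicit signed permutation matrix: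
`w̄ e_j = ± e_{w(j)}`. It is the unique family with `w̄ = φ_i (0 -1; 1 0)` for `w = s_i` and
`(uv)‾ = ū v̄` whenever `ℓ(uv) = ℓ(u) + ℓ(v)`; see `bar_simpleRefl` and `bar_mul`. -/
def bar (F : Type*) [DivisionRing F] (w : Equiv.Perm (Fin (r + 1))) : G F r where
  val := Matrix.of fun a b => if a = w b then barSign F w b else 0
  inv := Matrix.of fun a b => if b = w a then barSign F w a else 0
  val_inv := by
    ext a b
    rw [Matrix.mul_apply, Finset.sum_eq_single (w⁻¹ a)]
    · by_cases h : b = a <;> simp [Matrix.one_apply, h, barSign_mul_self, Ne.symm]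
    · intro c _ hc
      have hc' : a ≠ w c := fun h => hc (by simp [h])
      simp [hc']
    · simp
  inv_val := by
    ext a b
    rw [Matrix.mul_apply, Finset.sum_eq_single (w a)]
    · by_cases h : a = b <;> simp [Matrix.one_apply, h, barSign_mul_self]
    · intro c _ hc
      simp [hc]
    · simp

theorem bar_simpleRefl (i : Fin r) : bar F (simpleRefl i) = sBar F i := by
  have hne : i.castSucc ≠ i.succ := (Fin.castSucc_lt_succ).ne
  have key : ∀ j : Fin (r + 1), barSign F (simpleRefl i) j = if j = i.succ then -1 else 1 := by
    intro j
    have hs : (Finset.univ.filter fun k => k < j ∧ simpleRefl i j < simpleRefl i k) =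
        if j = i.succ then {i.castSucc} else ∅ := by
      ext k
      simp only [Finset.mem_filter, Finset.mem_univ, true_and]
      have h1 : i.castSucc < i.succ := Fin.castSucc_lt_succ
      have h2 : ∀ c : Fin (r + 1), c < i.succ ↔ c ≤ i.castSucc := by
        intro c; simp only [Fin.lt_def, Fin.le_def, Fin.val_succ, Fin.val_castSucc]; omega
      simp only [simpleRefl, Equiv.swap_apply_def]
      grind
    rw [barSign, hs]
    split_ifs <;> simp
  ext a b
  change (if a = simpleRefl i b then barSign F (simpleRefl i) b else 0) =
    phiMat i !![0, -1; 1, 0] a b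
  rw [key]
  by_cases ha : a = i.castSucc <;> by_cases ha' : a = i.succ <;>
    by_cases hb : b = i.castSucc <;> by_cases hb' : b = i.succ <;>
    simp_all [phiMat, simpleRefl, Equiv.swap_apply_def, Ne.symm hne, eq_comm]

/-- If `ℓ(uv) = ℓ(u) + ℓ(v)`, then every inversion of `v` is an inversion of `uv`. -/
theorem no_cancel {N : ℕ} (u v : Equiv.Perm (Fin N)) (h : length (u * v) = length u + length v)
    (k j : Fin N) (hkj : k < j) (hv : v j < v k) : u (v j) < u (v k) := by
  by_contra hcon
  let A := (inversions (u * v)).filter fun p => v p.1 < v p.2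
  let A' := (inversions (u * v)).filter fun p => ¬ v p.1 < v p.2
  have hA : A.card + A'.card = length (u * v) := Finset.card_filter_add_card_filter_not _
  have h1 : A.card ≤ (inversions u).card - 1 := by
    have hmem : (v j, v k) ∈ inversions u := by
      have : u (v k) < u (v j) := lt_of_le_of_ne (not_lt.mp hcon)
        (u.injective.ne (v.injective.ne hkj.ne))
      simp [inversions, hv, this]
    rw [← Finset.card_erase_of_mem hmem]
    refine Finset.card_le_card_of_injOn (fun p => (v p.1, v p.2)) ?_ ?_
    · rintro ⟨a, b⟩ hab
      simp only [A, inversions, Finset.mem_coe, Finset.mem_filter, Finset.mem_univ,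
        true_and] at hab
      simp only [inversions, Finset.mem_coe, Finset.mem_erase, Finset.mem_filter,
        Finset.mem_univ, true_and]
      refine ⟨?_, hab.2, hab.1.2⟩
      intro he
      obtain rfl := v.injective (congrArg Prod.fst he)
      obtain rfl := v.injective (congrArg Prod.snd he)
      exact absurd hab.1.1 hkj.not_gt
    · rintro ⟨a, b⟩ _ ⟨c, d⟩ _ hE
      simpa using hE
  have h2 : A'.card ≤ (inversions v).card := by
    refine Finset.card_le_card ?_
    rintro ⟨a, b⟩ hab
    simp only [A', inversions, Finset.mem_filter, Finset.mem_univ, true_and] at hab ⊢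
    exact ⟨hab.1.1, lt_of_le_of_ne (not_lt.mp hab.2) (v.injective.ne hab.1.1.ne')⟩
  have h3 : 0 < (inversions u).card := by
    refine Finset.card_pos.mpr ⟨(v j, v k), ?_⟩
    have : u (v k) < u (v j) := lt_of_le_of_ne (not_lt.mp hcon)
      (u.injective.ne (v.injective.ne hkj.ne))
    simp [inversions, hv, this]
  simp only [length] at h hA
  omega

theorem bar_mul (u v : Equiv.Perm (Fin (r + 1))) (h : length (u * v) = length u + length v) :
    bar F (u * v) = bar F u * bar F v := by
  have hdis := no_cancel u v h
  have hsign : ∀ j, barSign F (u * v) j = barSign F u (v j) * barSign F v j := by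
    intro j
    rw [barSign, barSign, barSign, ← pow_add]
    congr 1
    rw [← Finset.card_map (s := Finset.univ.filter fun k => k < v j ∧ u (v j) < u k)
      v.symm.toEmbedding, ← Finset.card_union_of_disjoint]
    · congr 1
      ext k
      simp only [Finset.mem_filter, Finset.mem_univ, true_and, Finset.mem_union, Finset.mem_map]
      constructor
      · rintro ⟨h1, h2⟩
        rcases lt_or_gt_of_ne (v.injective.ne h1.ne) with h3 | h3
        · exact Or.inl ⟨v k, ⟨h3, h2⟩, by simp⟩
        · exact Or.inr ⟨h1, h3⟩
      · rintro (⟨c, ⟨h1, h2⟩, rfl⟩ | ⟨h1, h2⟩)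
        · refine ⟨?_, by simpa using h2⟩
          by_contra h3
          rcases (not_lt.mp h3).lt_or_eq with h4 | h4
          · exact hdis _ _ h4 (by simpa using h1) |>.not_gt (by simpa using h2)
          · rw [h4] at h1; simp at h1
        · exact ⟨h1, hdis _ _ h1 h2⟩
    · rw [Finset.disjoint_left]
      simp only [Finset.mem_filter, Finset.mem_univ, true_and, Finset.mem_map]
      rintro k ⟨c, ⟨h1, -⟩, rfl⟩ ⟨-, h2⟩
      simp at h2
      exact absurd h1 h2.not_gt
  ext a b
  change (if a = (u * v) b then barSign F (u * v) b else 0) =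
    ∑ c, (if a = u c then barSign F u c else 0) * (if c = v b then barSign F v b else 0)
  rw [Finset.sum_eq_single (v b)]
  · simp [hsign]
  · intro c _ hc
    simp [hc]
  · simp

/-! ### Gauss factorization -/

/-- `x = l d p` with `l ∈ U⁻`, `d ∈ H`, `p ∈ U`. -/
structure IsLDU (x l d p : G F r) : Prop where
  lower : l ∈ Uminus F r
  diagonal : d ∈ H F r
  upper : p ∈ U F r
  eq : x = l * d * p

theorem U_mul {g g' : G F r} (h : g ∈ U F r) (h' : g' ∈ U F r) : g * g' ∈ U F r := by
  refine ⟨fun i j hij => ?_, fun i => ?_⟩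
  · change ∑ k, g.val i k * g'.val k j = 0
    refine Finset.sum_eq_zero fun k _ => ?_
    rcases lt_or_ge k i with hk | hk
    · rw [h.1 i k hk, zero_mul]
    · rw [h'.1 k j (hij.trans_le hk), mul_zero]
  · change ∑ k, g.val i k * g'.val k i = 1
    rw [Finset.sum_eq_single i, h.2, h'.2, mul_one]
    · intro k _ hk
      rcases lt_or_gt_of_ne hk with hk | hk
      · rw [h.1 i k hk, zero_mul]
      · rw [h'.1 k i hk, mul_zero]
    · simp

theorem U_inv {g : G F r} (h : g ∈ U F r) : g⁻¹ ∈ U F r := by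
  have key : ∀ i j, j ≤ i → (g⁻¹).val i j = if i = j then 1 else 0 := by
    intro i
    induction i using WellFoundedGT.induction with
    | ind i ih =>
      intro j hj
      have h1 : ∑ k, g.val i k * (g⁻¹).val k j = (1 : Matrix _ _ F) i j := by
        rw [← Matrix.mul_apply, ← Units.val_mul, mul_inv_cancel, Units.val_one]
      rw [Finset.sum_eq_single i, h.2, one_mul, Matrix.one_apply] at h1
      · exact h1
      · intro k _ hk
        rcases lt_or_gt_of_ne hk with hk | hk
        · rw [h.1 i k hk, zero_mul]
        · rw [ih k hk j (hj.trans hk.le), if_neg (hj.trans_lt hk).ne', mul_zero]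
      · simp
  exact ⟨fun i j hij => by rw [key i j hij.le, if_neg hij.ne'], fun i => by simp [key i i le_rfl]⟩

theorem Uminus_mul {g g' : G F r} (h : g ∈ Uminus F r) (h' : g' ∈ Uminus F r) :
    g * g' ∈ Uminus F r := by
  refine ⟨fun i j hij => ?_, fun i => ?_⟩
  · change ∑ k, g.val i k * g'.val k j = 0
    refine Finset.sum_eq_zero fun k _ => ?_
    rcases lt_or_ge i k with hk | hk
    · rw [h.1 i k hk, zero_mul]
    · rw [h'.1 k j (hk.trans_lt hij), mul_zero]
  · change ∑ k, g.val i k * g'.val k i = 1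
    rw [Finset.sum_eq_single i, h.2, h'.2, mul_one]
    · intro k _ hk
      rcases lt_or_gt_of_ne hk with hk | hk
      · rw [h'.1 k i hk, mul_zero]
      · rw [h.1 i k hk, zero_mul]
    · simp

theorem Uminus_inv {g : G F r} (h : g ∈ Uminus F r) : g⁻¹ ∈ Uminus F r := by
  have key : ∀ i j, i ≤ j → (g⁻¹).val i j = if i = j then 1 else 0 := by
    intro i
    induction i using WellFoundedLT.induction with
    | ind i ih =>
      intro j hj
      have h1 : ∑ k, g.val i k * (g⁻¹).val k j = (1 : Matrix _ _ F) i j := by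
        rw [← Matrix.mul_apply, ← Units.val_mul, mul_inv_cancel, Units.val_one]
      rw [Finset.sum_eq_single i, h.2, one_mul, Matrix.one_apply] at h1
      · exact h1
      · intro k _ hk
        rcases lt_or_gt_of_ne hk with hk | hk
        · rw [ih k hk j (hk.le.trans hj), if_neg (hk.trans_le hj).ne, mul_zero]
        · rw [h.1 i k hk, zero_mul]
      · simp
  exact ⟨fun i j hij => by rw [key i j hij.le, if_neg hij.ne], fun i => by simp [key i i le_rfl]⟩

theorem H_diag_ne_zero {d : G F r} (h : d ∈ H F r) (i : Fin (r + 1)) : d.val i i ≠ 0 := by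
  intro h0
  have h1 : ∑ k, d.val i k * (d⁻¹).val k i = (1 : Matrix _ _ F) i i := by
    rw [← Matrix.mul_apply, ← Units.val_mul, mul_inv_cancel, Units.val_one]
  rw [Finset.sum_eq_zero, Matrix.one_apply_eq] at h1
  · exact zero_ne_one h1
  · intro k _
    by_cases hk : i = k
    · subst hk; rw [h0, zero_mul]
    · rw [h i k hk, zero_mul]

theorem IsLDU.unique {x l d p l' d' p' : G F r} (h : IsLDU x l d p) (h' : IsLDU x l' d' p') :
    l = l' ∧ d = d' ∧ p = p' := by
  have hA := Uminus_mul (Uminus_inv h'.lower) h.lower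
  have hC := U_mul h'.upper (U_inv h.upper)
  have heq : l'⁻¹ * l * d = d' * (p' * p⁻¹) := by
    have h1 := h.eq.symm.trans h'.eq
    have h2 : l * d = l' * d' * p' * p⁻¹ := eq_mul_inv_of_mul_eq h1
    rw [mul_assoc, h2]
    group
  generalize l'⁻¹ * l = A at hA heq
  generalize hCdef : p' * p⁻¹ = C at hC heq
  have hent : ∀ i j, A.val i j * d.val j j = d'.val i i * C.val i j := by
    intro i j
    have h1 : (A * d).val i j = (d' * C).val i j := by rw [heq]
    rw [Units.val_mul, Units.val_mul, Matrix.mul_apply, Matrix.mul_apply,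
      Finset.sum_eq_single j, Finset.sum_eq_single i] at h1
    · exact h1
    · intro k _ hk
      rw [h'.diagonal i k hk.symm, zero_mul]
    · simp
    · intro k _ hk
      rw [h.diagonal k j hk, mul_zero]
    · simp
  have hd : d = d' := by
    ext i j
    by_cases hij : i = j
    · subst hij
      have h1 := hent i i
      rwa [hA.2, hC.2, one_mul, mul_one] at h1
    · rw [h.diagonal i j hij, h'.diagonal i j hij]
  have hC1 : C = 1 := by
    ext i j
    rw [Units.val_one, Matrix.one_apply]
    rcases lt_trichotomy i j with hij | hij | hij
    · have h1 := hent i j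
      rw [hA.1 i j hij, zero_mul] at h1
      rw [if_neg hij.ne]
      exact (mul_eq_zero.mp h1.symm).resolve_left (H_diag_ne_zero h'.diagonal i)
    · subst hij; rw [hC.2, if_pos rfl]
    · rw [hC.1 i j hij, if_neg hij.ne']
  have hp : p = p' := (mul_inv_eq_one.mp (hCdef.trans hC1)).symm
  refine ⟨?_, hd, hp⟩
  have h1 := h.eq.symm.trans h'.eq
  rw [hd, hp] at h1
  exact mul_right_cancel (mul_right_cancel h1)

/-- The Gauss cell `G_0`: the elements that have an `LDU`-factorization. -/
def G0 (F : Type*) [DivisionRing F] (r : ℕ) : Set (G F r) :=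
  {x | ∃ q : G F r × G F r × G F r, IsLDU x q.1 q.2.1 q.2.2}

open Classical in
/-- The `LDU`-factorization of `x ∈ G_0` (and `(1, 1, 1)` outside `G_0`). -/
noncomputable def ldu (x : G F r) : G F r × G F r × G F r :=
  if h : x ∈ G0 F r then Exists.choose h else (1, 1, 1)

/-- `[x]_- ∈ B⁻`, the product of the lower unitriangular and the diagonal component. -/
noncomputable def gaussMinus (x : G F r) : G F r := (ldu x).1 * (ldu x).2.1

/-- `[x]_0 ∈ H`, the diagonal component. -/
noncomputable def gaussZero (x : G F r) : G F r := (ldu x).2.1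

/-- `[x]_+ ∈ U`, the upper unitriangular component; `x = [x]_- [x]_+` for `x ∈ G_0`. -/
noncomputable def gaussPlus (x : G F r) : G F r := (ldu x).2.2

/-! ### Double Bruhat cells and the twist -/

/-- The double Bruhat cell `G^{u,v} = B u B ∩ B⁻ v B⁻`. -/
def doubleCell (F : Type*) [DivisionRing F] (u v : Equiv.Perm (Fin (r + 1))) : Set (G F r) :=
  DoubleCoset.doubleCoset (permElt F u) (B F r) (B F r) ∩
    DoubleCoset.doubleCoset (permElt F v) (Bminus F r) (Bminus F r)

/-- The reduced double Bruhat cell `L^{u,v} = U ū U ∩ B⁻ v B⁻`. -/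
def reducedCell (F : Type*) [DivisionRing F] (u v : Equiv.Perm (Fin (r + 1))) : Set (G F r) :=
  DoubleCoset.doubleCoset (bar F u) (U F r) (U F r) ∩
    DoubleCoset.doubleCoset (permElt F v) (Bminus F r) (Bminus F r)

/-- `J = diag(-1, 1, -1, …, (-1)^n)`. -/
def J (F : Type*) [DivisionRing F] (r : ℕ) : G F r :=
  diag fun i => (-1) ^ (i.val + 1)

/-- The positive inverse `x^ι = J x⁻¹ J`. -/
def iota (x : G F r) : G F r := J F r * x⁻¹ * J F r

/-- The twist on the reduced cell:
`ψ^{u,v}(x) = ([x (v⁻¹)‾]_-)^ι (x^ι)⁻¹ ([ū⁻¹ x]_+)^ι` for `x ∈ L^{u,v}`. -/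
noncomputable def reducedTwist (u v : Equiv.Perm (Fin (r + 1))) (x : G F r) : G F r :=
  iota (gaussMinus (x * bar F v⁻¹)) * (iota x)⁻¹ * iota (gaussPlus ((bar F u)⁻¹ * x))

open Classical in
/-- The twist `ψ^{u,v}` on `G^{u,v}`: if `g = h x` with `h ∈ H` and `x ∈ L^{u,v}`, then
`ψ^{u,v}(g) = h ψ^{u,v}(x)`. (Elements that are not of this form get the value `1`.) -/
noncomputable def twist (u v : Equiv.Perm (Fin (r + 1))) (g : G F r) : G F r :=
  if hg : ∃ h ∈ H F r, h⁻¹ * g ∈ reducedCell F u v then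
    hg.choose * reducedTwist u v (hg.choose⁻¹ * g)
  else 1

end Group

end DoubleBruhat

open DoubleBruhat

/-!
The twist becomes transparent once elements of Bruhat cells are written in normal form. Write
`v̂ = bar(v⁻¹)⁻¹`. An element `x` of `L^{u,v}` has two normal forms,

* `x = ū n p` with `p ∈ U` and `n ∈ U⁻ ∩ ū⁻¹ U ū` (`UpperForm`), and
* `x = q m v̂` with `q ∈ B⁻` and `m ∈ U ∩ v̂ U⁻ v̂⁻¹` (`LowerForm`),

and `ū⁻¹ x = n p`, `x bar(v⁻¹) = q m` are Gauss factorizations. Such normal forms exist because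
every group `w̄⁻¹ U w̄` is the product of its lower and its upper triangular part (`unip_factor`).
Hence `ψ(x) = J q⁻¹ x p⁻¹ J`. As `J ū J = û` (`J_conj_bar`), this equals both
`(J m J) v̄ (J p⁻¹ J)` and `(J q⁻¹ J) û (J n J)`, which are, up to moving a factor across `v̄` or `û`,
the two normal forms of `ψ(x)` as an element of `L^{v,u}` (`reducedTwist_forms`). Applying the
formula for the twist once more gives back `x`. The torus `H` is carried along: in `ū⁻¹ h x` the
diagonal Gauss factor is `ū⁻¹ h ū`, so `h` can be recovered from `h x`.

For the factorization parameters, `Δ^k_{w,w'}(y)` is the `k`-th diagonal entry of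
`[w̄⁻¹ y w̄']_-` whenever `w̄⁻¹ y w̄'` has a Gauss factorization (`delta_eq_of_gauss`). Cut the
product `x = h x₁ x₂` after some letter, with `x₁` of type `(u₁, v₁)` and `x₂` of type `(u₂, v₂)`.
Because lengths add up, the normal forms of `x₁` and `x₂` combine to normal forms of `x₁ x₂`, and
`v̄₁⁻¹ ψ(x) bar(u₂⁻¹)` turns out to be, up to `v̄₁⁻¹ h v̄₁`, of the form `U⁻ d⁻¹ U`, where `d` is the
diagonal part of `[x₂ bar(v₂⁻¹)]_-` (`delta_twist_mul`). Prepending a letter `-i` to `x₂` multiplies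
the entries `i`, `i + 1` of `d` by `t⁻¹`, `t`; prepending a letter `i` exchanges these entries up to
the factors `t`, `t⁻¹` (`exists_lowerForm_xPos_mul`). So `t` is the ratio of quasiminors at
consecutive cuts.
-/

namespace DoubleBruhat

/-! ### Borel subgroups of the orderings of the index set -/

section Triangular

variable {F : Type*} [DivisionRing F] {r : ℕ}

/-- If `g` is triangular for the order `σ`, then row `i` of `g * g⁻¹ = 1` reads
`g_{ii} (g⁻¹)_{ij} = δ_{ij}` on and below the diagonal. -/
theorem triangular_inv_apply {σ : Equiv.Perm (Fin (r + 1))} {g : G F r}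
    (h : ∀ i j, σ j < σ i → g.val i j = 0) (i j : Fin (r + 1)) (hj : σ j ≤ σ i) :
    g.val i i * (g⁻¹).val i j = if i = j then 1 else 0 := by
  induction hn : σ i using WellFoundedGT.induction generalizing i j with
  | ind n ih =>
    subst hn
    have h1 : ∑ k, g.val i k * (g⁻¹).val k j = (1 : Matrix _ _ F) i j := by
      rw [← Matrix.mul_apply, ← Units.val_mul, mul_inv_cancel, Units.val_one]
    rw [Finset.sum_eq_single i, Matrix.one_apply] at h1
    · exact h1
    · intro k _ hk
      rcases lt_or_gt_of_ne (σ.injective.ne hk) with hk | hk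
      · rw [h i k hk, zero_mul]
      · have h2 := ih (σ k) hk k k le_rfl rfl
        have h3 := ih (σ k) hk k j (hj.trans hk.le) rfl
        rw [if_pos rfl] at h2
        rw [if_neg (fun e => (hj.trans_lt hk).ne' (congrArg σ e))] at h3
        rw [(mul_eq_zero.mp h3).resolve_left (left_ne_zero_of_mul (h2 ▸ one_ne_zero)), mul_zero]
    · simp

/-- The Borel subgroup of the matrices that are upper triangular for the order of the indices in
which `i` precedes `j` iff `σ i < σ j`. -/
def borel (F : Type*) [DivisionRing F] {r : ℕ} (σ : Equiv.Perm (Fin (r + 1))) :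
    Subgroup (G F r) where
  carrier := {g | ∀ i j, σ j < σ i → g.val i j = 0}
  one_mem' i j hij := Matrix.one_apply_ne fun e => hij.ne' (congrArg σ e)
  mul_mem' := by
    intro g g' h h' i j hij
    change ∑ k, g.val i k * g'.val k j = 0
    refine Finset.sum_eq_zero fun k _ => ?_
    rcases lt_or_ge (σ k) (σ i) with hk | hk
    · rw [h i k hk, zero_mul]
    · rw [h' k j (hij.trans_le hk), mul_zero]
  inv_mem' := by
    intro g h i j hij
    have h1 := triangular_inv_apply h i j hij.le
    have h2 := triangular_inv_apply h i i le_rfl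
    rw [if_pos rfl] at h2
    rw [if_neg (fun e => hij.ne' (congrArg σ e))] at h1
    exact (mul_eq_zero.mp h1).resolve_left (left_ne_zero_of_mul (h2 ▸ one_ne_zero))

variable {σ : Equiv.Perm (Fin (r + 1))}

theorem borel_diag_mul {g g' : G F r} (h : g ∈ borel F σ) (h' : g' ∈ borel F σ)
    (i : Fin (r + 1)) : (g * g').val i i = g.val i i * g'.val i i := by
  change ∑ k, g.val i k * g'.val k i = _
  refine Finset.sum_eq_single i (fun k _ hk => ?_) (by simp)
  rcases lt_or_gt_of_ne (σ.injective.ne hk) with hk | hk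
  · rw [h i k hk, zero_mul]
  · rw [h' k i hk, mul_zero]

theorem borel_diag_ne_zero {g : G F r} (h : g ∈ borel F σ) (i : Fin (r + 1)) :
    g.val i i ≠ 0 := by
  have h1 := borel_diag_mul h (inv_mem h) i
  rw [mul_inv_cancel, Units.val_one, Matrix.one_apply_eq] at h1
  exact left_ne_zero_of_mul (h1 ▸ one_ne_zero)

theorem borel_diag_inv {g : G F r} (h : g ∈ borel F σ) (i : Fin (r + 1)) :
    (g⁻¹).val i i = (g.val i i)⁻¹ := by
  have h1 := borel_diag_mul h (inv_mem h) i
  rw [mul_inv_cancel, Units.val_one, Matrix.one_apply_eq] at h1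
  exact eq_inv_of_mul_eq_one_right h1.symm

/-- The unipotent radical of `borel F σ`. -/
def unip (F : Type*) [DivisionRing F] {r : ℕ} (σ : Equiv.Perm (Fin (r + 1))) :
    Subgroup (G F r) where
  carrier := {g | g ∈ borel F σ ∧ ∀ i, g.val i i = 1}
  one_mem' := ⟨one_mem _, fun i => Matrix.one_apply_eq i⟩
  mul_mem' := fun h h' => ⟨mul_mem h.1 h'.1, fun i => by
    rw [borel_diag_mul h.1 h'.1, h.2, h'.2, mul_one]⟩
  inv_mem' := fun h => ⟨inv_mem h.1, fun i => by rw [borel_diag_inv h.1, h.2, inv_one]⟩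

/-- The torus of diagonal matrices, as a subgroup. -/
def torus (F : Type*) [DivisionRing F] (r : ℕ) : Subgroup (G F r) where
  carrier := H F r
  one_mem' i j hij := Matrix.one_apply_ne hij
  mul_mem' := by
    intro g g' h h' i j hij
    change ∑ k, g.val i k * g'.val k j = 0
    refine Finset.sum_eq_zero fun k _ => ?_
    by_cases hk : i = k
    · rw [h' k j (hk ▸ hij), mul_zero]
    · rw [h i k hk, zero_mul]
  inv_mem' := by
    intro g h i j hij
    have hb : ∀ σ : Equiv.Perm (Fin (r + 1)), g ∈ borel F σ :=
      fun σ a b hab => h a b fun e => hab.ne' (congrArg σ e)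
    rcases lt_or_gt_of_ne hij with hij | hij
    · exact inv_mem (hb Fin.revPerm) i j (Fin.rev_lt_rev.mpr hij)
    · exact inv_mem (hb 1) i j hij

theorem torus_le_borel : torus F r ≤ borel F σ :=
  fun _ h i j hij => h i j fun e => hij.ne' (congrArg σ e)

theorem mem_B {g : G F r} : g ∈ B F r ↔ g ∈ borel F 1 := Iff.rfl

theorem mem_H {g : G F r} : g ∈ H F r ↔ g ∈ torus F r := Iff.rfl

theorem mem_Bminus {g : G F r} : g ∈ Bminus F r ↔ g ∈ borel F Fin.revPerm :=
  ⟨fun h i j hij => h i j (Fin.rev_lt_rev.mp hij), fun h i j hij => h i j (Fin.rev_lt_rev.mpr hij)⟩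

theorem mem_Uminus {g : G F r} : g ∈ Uminus F r ↔ g ∈ unip F Fin.revPerm :=
  and_congr_left fun _ => mem_Bminus

theorem torus_mul_apply {d : G F r} (h : d ∈ torus F r) (g : G F r) (i j : Fin (r + 1)) :
    (d * g).val i j = d.val i i * g.val i j := by
  change ∑ k, d.val i k * g.val k j = _
  exact Finset.sum_eq_single i (fun k _ hk => by rw [h i k hk.symm, zero_mul]) (by simp)

theorem mul_torus_apply {d : G F r} (h : d ∈ torus F r) (g : G F r) (i j : Fin (r + 1)) :
    (g * d).val i j = g.val i j * d.val j j := by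
  change ∑ k, g.val i k * d.val k j = _
  exact Finset.sum_eq_single j (fun k _ hk => by rw [h k j hk, mul_zero]) (by simp)

theorem torus_conj_unip {d g : G F r} (h : d ∈ torus F r) (hg : g ∈ unip F σ) :
    d * g * d⁻¹ ∈ unip F σ := by
  have hd := torus_le_borel (σ := σ) h
  refine ⟨mul_mem (mul_mem hd hg.1) (inv_mem hd), fun i => ?_⟩
  rw [borel_diag_mul (mul_mem hd hg.1) (inv_mem hd), borel_diag_mul hd hg.1, hg.2, mul_one,
    borel_diag_inv hd, mul_inv_cancel₀ (borel_diag_ne_zero hd i)]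

theorem diag_mem_torus (h : Fin (r + 1) → Fˣ) : diag h ∈ torus F r :=
  fun _ _ hij => Matrix.diagonal_apply_ne _ hij

theorem diag_apply_self (h : Fin (r + 1) → Fˣ) (i : Fin (r + 1)) : (diag h).val i i = h i :=
  Matrix.diagonal_apply_eq _ i

/-- The Levi decomposition `borel = torus ⋉ unip`. -/
theorem borel_levi {g : G F r} (h : g ∈ borel F σ) :
    ∃ d ∈ torus F r, ∃ n ∈ unip F σ, g = n * d ∧ ∀ i, d.val i i = g.val i i := by
  let d : G F r := diag fun i => Units.mk0 _ (borel_diag_ne_zero h i)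
  have hd : d ∈ torus F r := diag_mem_torus _
  have hdi : ∀ i, d.val i i = g.val i i := fun i => diag_apply_self _ i
  refine ⟨d, hd, g * d⁻¹, ⟨mul_mem h (inv_mem (torus_le_borel hd)), fun i => ?_⟩, by group, hdi⟩
  rw [borel_diag_mul h (inv_mem (torus_le_borel hd)), borel_diag_inv (torus_le_borel (σ := σ) hd),
    hdi, mul_inv_cancel₀ (borel_diag_ne_zero h i)]

theorem borel_levi' {g : G F r} (h : g ∈ borel F σ) :
    ∃ d ∈ torus F r, ∃ n ∈ unip F σ, g = d * n := by
  obtain ⟨d, hd, n, hn, rfl, -⟩ := borel_levi h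
  refine ⟨d, hd, d⁻¹ * n * d, ?_, by group⟩
  simpa using torus_conj_unip (inv_mem hd) hn

end Triangular

/-! ### Gauss factorizations -/

section Gauss

variable {F : Type*} [DivisionRing F] {r : ℕ}

/-- A product `q p` with `q ∈ B⁻` and `p ∈ U` is a Gauss factorization: `[q p]_- = q`,
`[q p]_+ = p`, and `[q p]_0` is the diagonal of `q`. -/
theorem gauss_mul {q p : G F r} (hq : q ∈ borel F Fin.revPerm) (hp : p ∈ unip F 1) :
    q * p ∈ G0 F r ∧ gaussMinus (q * p) = q ∧ gaussPlus (q * p) = p ∧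
      gaussZero (q * p) ∈ torus F r ∧ ∀ i, (gaussZero (q * p)).val i i = q.val i i := by
  obtain ⟨d, hd, l, hl, rfl, hdi⟩ := borel_levi hq
  have hldu : IsLDU (l * d * p) l d p := ⟨mem_Uminus.mpr hl, hd, hp, rfl⟩
  have hmem : l * d * p ∈ G0 F r := ⟨(l, d, p), hldu⟩
  have hspec : IsLDU (l * d * p) (ldu (l * d * p)).1 (ldu (l * d * p)).2.1
      (ldu (l * d * p)).2.2 := by
    rw [ldu, dif_pos hmem]
    exact hmem.choose_spec
  obtain ⟨h1, h2, h3⟩ := hldu.unique hspec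
  refine ⟨hmem, ?_, h3.symm, ?_⟩
  · rw [gaussMinus, ← h1, ← h2]
  · rw [gaussZero, ← h2]
    exact ⟨hd, hdi⟩

/-- The recursion that solves `A = L * P` entry by entry: `factorEntry σ A i j` is the sum of the
`(i, j)`-entries of `L` and `P`, only one of which is nonzero. -/
def factorEntry (σ : Equiv.Perm (Fin (r + 1))) (A : Matrix (Fin (r + 1)) (Fin (r + 1)) F)
    (i j : Fin (r + 1)) : F :=
  A i j - ∑ k, if _h : σ i < σ k ∧ σ k < σ j then
    (if k < i then factorEntry σ A i k else 0) * (if k < j then factorEntry σ A k j else 0) else 0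
termination_by (σ j).val - (σ i).val
decreasing_by all_goals (simp only [Fin.lt_def] at _h; omega)

/-- The factor `L` (for `c i j := j < i`) or `P` (for `c i j := i < j`). -/
def factorPart (σ : Equiv.Perm (Fin (r + 1))) (A : Matrix (Fin (r + 1)) (Fin (r + 1)) F)
    (c : Fin (r + 1) → Fin (r + 1) → Prop) [DecidableRel c] :
    Matrix (Fin (r + 1)) (Fin (r + 1)) F :=
  Matrix.of fun i j =>
    if i = j then 1 else if c i j ∧ σ i < σ j then factorEntry σ A i j else 0

theorem factorPart_self {σ : Equiv.Perm (Fin (r + 1))} {A : Matrix (Fin (r + 1)) (Fin (r + 1)) F}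
    {c : Fin (r + 1) → Fin (r + 1) → Prop} [DecidableRel c] (i : Fin (r + 1)) :
    factorPart σ A c i i = 1 := by
  simp [factorPart]

theorem factorPart_eq_zero {σ : Equiv.Perm (Fin (r + 1))}
    {A : Matrix (Fin (r + 1)) (Fin (r + 1)) F} {c : Fin (r + 1) → Fin (r + 1) → Prop}
    [DecidableRel c] {i j : Fin (r + 1)} (hij : i ≠ j) (h : ¬ (c i j ∧ σ i < σ j)) :
    factorPart σ A c i j = 0 := by
  rw [factorPart, Matrix.of_apply, if_neg hij, if_neg h]

theorem factorPart_mul_apply {σ : Equiv.Perm (Fin (r + 1))}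
    {A : Matrix (Fin (r + 1)) (Fin (r + 1)) F} {i j k : Fin (r + 1)} (hi : k ≠ i) (hj : k ≠ j) :
    factorPart σ A (fun i j => j < i) i k * factorPart σ A (fun i j => i < j) k j =
      if σ i < σ k ∧ σ k < σ j then
        (if k < i then factorEntry σ A i k else 0) * (if k < j then factorEntry σ A k j else 0)
      else 0 := by
  simp only [factorPart, Matrix.of_apply, if_neg hi.symm, if_neg hj]
  by_cases h1 : σ i < σ k <;> by_cases h2 : σ k < σ j <;> simp [h1, h2]

theorem factorPart_mul (σ : Equiv.Perm (Fin (r + 1))) (g : G F r) (hg : g ∈ unip F σ) :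
    factorPart σ g.val (fun i j => j < i) * factorPart σ g.val (fun i j => i < j) = g.val := by
  ext i j
  rw [Matrix.mul_apply]
  by_cases hij : i = j
  · subst hij
    rw [Finset.sum_eq_single i, hg.2]
    · simp [factorPart]
    · intro k _ hk
      rw [factorPart_mul_apply hk hk, if_neg fun h => h.1.not_gt h.2]
    · simp
  by_cases hs : σ i < σ j
  · rw [Fintype.sum_eq_add_sum_compl, Finset.compl_eq_univ_sdiff, Finset.sdiff_singleton_eq_erase,
      ← Finset.add_sum_erase _ _ (Finset.mem_erase.mpr ⟨Ne.symm hij, Finset.mem_univ j⟩)]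
    have h1 : g.val i j = factorEntry σ g.val i j + ∑ k, if σ i < σ k ∧ σ k < σ j then
        (if k < i then factorEntry σ g.val i k else 0) *
          (if k < j then factorEntry σ g.val k j else 0) else 0 := by
      conv_rhs => rw [factorEntry]
      simp
    rw [h1, ← add_assoc]
    congr 1
    · simp only [factorPart, Matrix.of_apply]
      rcases lt_or_gt_of_ne hij with h | h
      · simp [hij, hs, h, h.not_gt]
      · simp [hij, hs, h, h.not_gt]
    · rw [← Finset.sum_subset (Finset.subset_univ ((Finset.univ.erase i).erase j))]
      · refine Finset.sum_congr rfl fun k hk => ?_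
        simp only [Finset.mem_erase, Finset.mem_univ, and_true] at hk
        exact factorPart_mul_apply hk.2 hk.1
      · intro k _ hk
        simp only [Finset.mem_erase, Finset.mem_univ, and_true] at hk
        grind
  · have h0 : σ j < σ i := lt_of_le_of_ne (not_lt.mp hs) (σ.injective.ne (Ne.symm hij))
    rw [hg.1 i j h0]
    refine Finset.sum_eq_zero fun k _ => ?_
    by_cases hi : k = i
    · subst hi
      rw [factorPart_eq_zero hij fun h => hs h.2, mul_zero]
    by_cases hj : k = j
    · subst hj
      rw [factorPart_eq_zero hij fun h => hs h.2, zero_mul]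
    rw [factorPart_mul_apply hi hj, if_neg fun h => hs (h.1.trans h.2)]

/-- Every unipotent group `unip F σ` is the product of its lower and its upper triangular part. -/
theorem unip_factor {σ : Equiv.Perm (Fin (r + 1))} {g : G F r} (hg : g ∈ unip F σ) :
    ∃ l ∈ unip F σ, ∃ p ∈ unip F σ, l ∈ unip F Fin.revPerm ∧ p ∈ unip F 1 ∧ g = l * p := by
  have hmul := factorPart_mul σ g hg
  have hL : factorPart σ g.val (fun i j => j < i) *
      (factorPart σ g.val (fun i j => i < j) * (g⁻¹).val) = 1 := by
    rw [← Matrix.mul_assoc, hmul, ← Units.val_mul, mul_inv_cancel, Units.val_one]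
  have hP : (g⁻¹).val * factorPart σ g.val (fun i j => j < i) *
      factorPart σ g.val (fun i j => i < j) = 1 := by
    rw [Matrix.mul_assoc, hmul, ← Units.val_mul, inv_mul_cancel, Units.val_one]
  refine ⟨⟨_, _, hL, mul_eq_one_comm.mp hL⟩, ?_, ⟨_, _, mul_eq_one_comm.mp hP, hP⟩, ?_, ?_, ?_,
    Units.ext hmul.symm⟩
  all_goals
    refine ⟨fun i j hij => (factorPart_eq_zero ?_ ?_), fun i => factorPart_self i⟩
    · rintro rfl
      exact lt_irrefl _ hij
    · rintro ⟨h1, h2⟩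
      first | exact h2.not_gt hij | exact h1.not_gt hij | exact h1.not_gt (Fin.rev_lt_rev.mp hij)

end Gauss

/-! ### Conjugation by the representatives of permutations -/

section Conj

variable {F : Type*} [DivisionRing F] {r : ℕ}

theorem bar_conj_apply (w w' : Equiv.Perm (Fin (r + 1))) (y : G F r) (i j : Fin (r + 1)) :
    ((bar F w)⁻¹ * y * bar F w').val i j =
      barSign F w i * y.val (w i) (w' j) * barSign F w' j := by
  change ∑ k, (∑ l, (if l = w i then barSign F w i else 0) * y.val l k) *
    (if k = w' j then barSign F w' j else 0) = _
  simp

theorem barSign_mul_comm (w : Equiv.Perm (Fin (r + 1))) (j : Fin (r + 1)) (a : F) :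
    barSign F w j * a = a * barSign F w j :=
  ((Commute.neg_one_left a).pow_left _).eq

/-- Conjugation by `w̄` permutes the diagonal entries without a sign. -/
theorem bar_conj_apply_self (w : Equiv.Perm (Fin (r + 1))) (y : G F r) (i : Fin (r + 1)) :
    ((bar F w)⁻¹ * y * bar F w).val i i = y.val (w i) (w i) := by
  rw [bar_conj_apply, barSign_mul_comm, mul_assoc, barSign_mul_self, mul_one]

theorem bar_conj_mem_borel {σ : Equiv.Perm (Fin (r + 1))} (w : Equiv.Perm (Fin (r + 1)))
    {y : G F r} (hy : y ∈ borel F σ) : (bar F w)⁻¹ * y * bar F w ∈ borel F (σ * w) := by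
  intro i j hij
  rw [bar_conj_apply, hy _ _ hij, mul_zero, zero_mul]

theorem bar_conj_mem_unip {σ : Equiv.Perm (Fin (r + 1))} (w : Equiv.Perm (Fin (r + 1)))
    {y : G F r} (hy : y ∈ unip F σ) : (bar F w)⁻¹ * y * bar F w ∈ unip F (σ * w) :=
  ⟨bar_conj_mem_borel w hy.1, fun i => by rw [bar_conj_apply_self, hy.2]⟩

theorem bar_conj_mem_torus (w : Equiv.Perm (Fin (r + 1))) {y : G F r} (hy : y ∈ torus F r) :
    (bar F w)⁻¹ * y * bar F w ∈ torus F r := by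
  intro i j hij
  rw [bar_conj_apply, hy _ _ (w.injective.ne hij), mul_zero, zero_mul]

theorem bar_one : bar F (1 : Equiv.Perm (Fin (r + 1))) = 1 := by
  ext i j
  change (if i = j then barSign F 1 j else 0) = (1 : Matrix _ _ F) i j
  have h : barSign F (1 : Equiv.Perm (Fin (r + 1))) j = 1 := by
    rw [barSign, Finset.card_eq_zero.mpr, pow_zero]
    exact Finset.filter_eq_empty_iff.mpr fun k _ h => h.1.not_gt h.2
  rw [h, Matrix.one_apply]

/-- The representative `w̄` and the permutation matrix of `w` differ by a diagonal matrix. -/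
theorem bar_eq_permElt_mul (w : Equiv.Perm (Fin (r + 1))) :
    ∃ d ∈ torus F r, bar F w = permElt F w * d := by
  let d : G F r := diag fun j => ⟨barSign F w j, barSign F w j, barSign_mul_self w j,
    barSign_mul_self w j⟩
  refine ⟨d, diag_mem_torus _, ?_⟩
  ext i j
  rw [mul_torus_apply (diag_mem_torus _), diag_apply_self]
  change (if i = w j then barSign F w j else 0) = (if i = w j then 1 else 0) * barSign F w j
  simp

theorem permElt_inv (w : Equiv.Perm (Fin (r + 1))) : permElt F w⁻¹ = (permElt F w)⁻¹ := by
  ext i j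
  change (if i = w⁻¹ j then (1 : F) else 0) = if j = w i then 1 else 0
  simp [Equiv.eq_symm_apply, eq_comm]

/-- The number of inversions in which `j` is the right end and in which it is the left end differ
by `w j - j`. -/
theorem card_inversions_add (w : Equiv.Perm (Fin (r + 1))) (j : Fin (r + 1)) :
    (Finset.univ.filter fun k => k < j ∧ w j < w k).card + (w j).val =
      (Finset.univ.filter fun k => j < k ∧ w k < w j).card + j.val := by
  have h1 : (Finset.univ.filter fun k => k < j).card = j.val := by
    rw [← Fin.card_Iio j]
    congr 1
    ext k
    simp
  have h2 : (Finset.univ.filter fun k => w k < w j).card = (w j).val := by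
    rw [← Fin.card_Iio (w j), ← Finset.card_map w.toEmbedding]
    congr 1
    ext k
    simp only [Finset.mem_map, Finset.mem_filter, Finset.mem_univ, true_and, Finset.mem_Iio]
    exact ⟨by rintro ⟨a, ha, rfl⟩; exact ha, fun hk => ⟨w⁻¹ k, by simpa using hk, by simp⟩⟩
  rw [← h1, ← h2, ← Finset.card_filter_add_card_filter_not (s := Finset.univ.filter fun k => k < j)
    (fun k => w j < w k), ← Finset.card_filter_add_card_filter_not
    (s := Finset.univ.filter fun k => w k < w j) (fun k => j < k)]
  simp only [Finset.filter_filter]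
  have h3 : (Finset.univ.filter fun k => w k < w j ∧ j < k) =
      Finset.univ.filter fun k => j < k ∧ w k < w j :=
    Finset.filter_congr fun k _ => and_comm
  have h4 : (Finset.univ.filter fun k => w k < w j ∧ ¬ j < k) =
      Finset.univ.filter fun k => k < j ∧ ¬ w j < w k := by
    refine Finset.filter_congr fun k _ => ?_
    rcases eq_or_ne k j with rfl | hk
    · simp
    · have := w.injective.ne hk
      constructor
      · exact fun h => ⟨lt_of_le_of_ne (not_lt.mp h.2) hk, h.1.not_gt⟩
      · exact fun h => ⟨lt_of_le_of_ne (not_lt.mp h.2) this, h.1.not_gt⟩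
  rw [h3, h4]
  omega

theorem J_mem_torus : J F r ∈ torus F r := diag_mem_torus _

theorem J_mul_J : J F r * J F r = 1 := by
  ext i j
  rw [torus_mul_apply J_mem_torus, J, diag_apply_self]
  change _ * Matrix.diagonal _ i j = (1 : Matrix _ _ F) i j
  rw [Matrix.diagonal_apply, Matrix.one_apply]
  split_ifs
  · beta_reduce
    rw [← Units.val_mul, ← pow_add, Even.neg_one_pow ⟨_, rfl⟩, Units.val_one]
  · simp

theorem J_inv : (J F r)⁻¹ = J F r := inv_eq_of_mul_eq_one_right J_mul_J

theorem J_conj_mem_unip {σ : Equiv.Perm (Fin (r + 1))} {g : G F r} (hg : g ∈ unip F σ) :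
    J F r * g * J F r ∈ unip F σ := by
  conv in _ * J F r => rw [← J_inv]
  exact torus_conj_unip J_mem_torus hg

theorem J_mem_borel {σ : Equiv.Perm (Fin (r + 1))} : J F r ∈ borel F σ :=
  torus_le_borel J_mem_torus

/-- The automorphism `x ↦ J x J` takes `w̄` to the representative `bar(w⁻¹)⁻¹` of `w`. -/
theorem J_conj_bar (w : Equiv.Perm (Fin (r + 1))) : J F r * bar F w * J F r = (bar F w⁻¹)⁻¹ := by
  ext i j
  rw [mul_torus_apply J_mem_torus, torus_mul_apply J_mem_torus, J, diag_apply_self,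
    diag_apply_self]
  change _ * (if i = w j then barSign F w j else 0) * _ = if j = w⁻¹ i then barSign F w⁻¹ i else 0
  by_cases h : i = w j
  · subst h
    have hc : (Finset.univ.filter fun k => k < w j ∧ w⁻¹ (w j) < w⁻¹ k).card =
        (Finset.univ.filter fun k => j < k ∧ w k < w j).card := by
      rw [← Finset.card_map w.toEmbedding (s := Finset.univ.filter fun k => j < k ∧ w k < w j)]
      congr 1
      ext k
      simp only [Finset.mem_map, Finset.mem_filter, Finset.mem_univ, true_and]
      constructor
      · rintro ⟨h1, h2⟩
        exact ⟨w⁻¹ k, ⟨by simpa using h2, by simpa using h1⟩, by simp⟩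
      · rintro ⟨a, ⟨h1, h2⟩, rfl⟩
        simpa using ⟨h2, h1⟩
    have hadd := card_inversions_add w j
    rw [if_pos rfl, if_pos (by simp), barSign, barSign, hc]
    push_cast
    rw [← pow_add, ← pow_add]
    have he : (w j).val + 1 + (Finset.univ.filter fun k => k < j ∧ w j < w k).card + (j.val + 1) =
        (Finset.univ.filter fun k => j < k ∧ w k < w j).card + 2 * (j.val + 1) := by omega
    rw [he, pow_add, pow_mul]
    simp
  · rw [if_neg h, if_neg (fun e => h (by rw [e]; simp)), mul_zero, zero_mul]

/-- Conjugation by `w̄` in terms of conjugation by `bar(w⁻¹)⁻¹`. -/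
theorem bar_conj_inv_eq (w : Equiv.Perm (Fin (r + 1))) (y : G F r) :
    bar F w * y * (bar F w)⁻¹ =
      J F r * ((bar F w⁻¹)⁻¹ * (J F r * y * J F r) * bar F w⁻¹) * J F r := by
  have h1 := J_conj_bar (F := F) w⁻¹
  have h2 := congrArg (·⁻¹) h1
  simp only [inv_inv, mul_inv_rev, J_inv] at h1 h2
  rw [← h1, ← h2]
  simp only [mul_assoc]

theorem bar_conj_inv_mem_unip {σ : Equiv.Perm (Fin (r + 1))} (w : Equiv.Perm (Fin (r + 1)))
    {y : G F r} (hy : y ∈ unip F σ) : bar F w * y * (bar F w)⁻¹ ∈ unip F (σ * w⁻¹) := by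
  rw [bar_conj_inv_eq]
  exact J_conj_mem_unip (bar_conj_mem_unip _ (J_conj_mem_unip hy))

theorem bar_conj_inv_mem_torus (w : Equiv.Perm (Fin (r + 1))) {y : G F r} (hy : y ∈ torus F r) :
    bar F w * y * (bar F w)⁻¹ ∈ torus F r := by
  rw [bar_conj_inv_eq]
  exact mul_mem (mul_mem J_mem_torus (bar_conj_mem_torus _
    (mul_mem (mul_mem J_mem_torus hy) J_mem_torus))) J_mem_torus

end Conj

/-! ### Length-additive products and unipotent groups -/

section Additive

variable {F : Type*} [DivisionRing F] {r : ℕ} {u w : Equiv.Perm (Fin (r + 1))}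

/-- If lengths add up, every inversion of `w` is one of `u w`, so
`U⁻ ∩ w̄⁻¹ U w̄` is contained in `(u w)⁻¹ U (u w)`. -/
theorem unip_mul_left (h : length (u * w) = length u + length w) {g : G F r}
    (h1 : g ∈ unip F Fin.revPerm) (h2 : g ∈ unip F w) : g ∈ unip F (u * w) := by
  refine ⟨fun i j hij => ?_, h1.2⟩
  have hne : i ≠ j := fun e => hij.ne' (congrArg _ e)
  rcases lt_or_gt_of_ne hne with h3 | h3
  · exact h1.1 i j (Fin.rev_lt_rev.mpr h3)
  · rcases lt_or_gt_of_ne (w.injective.ne hne) with h4 | h4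
    · exact absurd hij (no_cancel u w h j i h3 h4).not_gt
    · exact h2.1 i j h4

/-- The mirror image of `unip_mul_left`: the roles of `U` and `U⁻` are exchanged. -/
theorem unip_rev_mul_left (h : length (u * w) = length u + length w) {g : G F r}
    (h1 : g ∈ unip F 1) (h2 : g ∈ unip F (Fin.revPerm * w)) :
    g ∈ unip F (Fin.revPerm * (u * w)) := by
  refine ⟨fun i j hij => ?_, h1.2⟩
  replace hij : u (w i) < u (w j) := Fin.rev_lt_rev.mp hij
  have hne : i ≠ j := fun e => hij.ne (congrArg (fun k => u (w k)) e)
  rcases lt_or_gt_of_ne hne with h3 | h3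
  · rcases lt_or_gt_of_ne (w.injective.ne hne) with h4 | h4
    · exact h2.1 i j (Fin.rev_lt_rev.mpr h4)
    · exact absurd hij (no_cancel u w h i j h3 h4).not_gt
  · exact h1.1 i j h3

/-- If lengths add up, conjugation by `w̄⁻¹` keeps `U⁻ ∩ ū⁻¹ U ū` inside `U⁻`: a pair of indices
whose order is reversed by `w` keeps the reversed order under `u w`. -/
theorem bar_conj_mem_unip_rev (h : length (u * w) = length u + length w) {g : G F r}
    (h1 : g ∈ unip F Fin.revPerm) (h2 : g ∈ unip F u) :
    (bar F w)⁻¹ * g * bar F w ∈ unip F Fin.revPerm := by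
  refine ⟨fun i j hij => ?_, (bar_conj_mem_unip w h1).2⟩
  replace hij : i < j := Fin.rev_lt_rev.mp hij
  rw [bar_conj_apply]
  rcases lt_or_gt_of_ne (w.injective.ne hij.ne) with h4 | h4
  · rw [h1.1 _ _ (Fin.rev_lt_rev.mpr h4), mul_zero, zero_mul]
  · rw [h2.1 _ _ (no_cancel u w h i j hij h4), mul_zero, zero_mul]

/-- The mirror image of `bar_conj_mem_unip_rev`: the roles of `U` and `U⁻` are exchanged. -/
theorem bar_conj_mem_unip_one (h : length (u * w) = length u + length w) {g : G F r}
    (h1 : g ∈ unip F 1) (h2 : g ∈ unip F (Fin.revPerm * u)) :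
    (bar F w)⁻¹ * g * bar F w ∈ unip F 1 := by
  refine ⟨fun i j hij => ?_, (bar_conj_mem_unip w h1).2⟩
  replace hij : j < i := hij
  rw [bar_conj_apply]
  rcases lt_or_gt_of_ne (w.injective.ne hij.ne) with h4 | h4
  · have h5 : g.val (w i) (w j) = 0 := h1.1 _ _ h4
    rw [h5, mul_zero, zero_mul]
  · rw [h2.1 _ _ (Fin.rev_lt_rev.mpr (no_cancel u w h j i hij h4)), mul_zero, zero_mul]

end Additive

/-! ### Normal forms in Bruhat cells -/

section Cells

variable {F : Type*} [DivisionRing F] {r : ℕ} {u v : Equiv.Perm (Fin (r + 1))}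

/-- The normal form `x = ū n p` of an element of `U ū U`: `p ∈ U` and
`n ∈ U⁻ ∩ ū⁻¹ U ū`. Then `ū⁻¹ x = n p` is a Gauss factorization. -/
structure UpperForm (u : Equiv.Perm (Fin (r + 1))) (x n p : G F r) : Prop where
  conj : n ∈ unip F u
  lower : n ∈ unip F Fin.revPerm
  upper : p ∈ unip F 1
  eq : x = bar F u * n * p

/-- The normal form `x = q m v̂` of an element of `B⁻ v B⁻`, where `v̂ = bar(v⁻¹)⁻¹`:
`q ∈ B⁻` and `m ∈ U ∩ v̂ U⁻ v̂⁻¹`. Then `x bar(v⁻¹) = q m` is a Gauss factorization. -/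
structure LowerForm (v : Equiv.Perm (Fin (r + 1))) (x q m : G F r) : Prop where
  lower : q ∈ borel F Fin.revPerm
  upper : m ∈ unip F 1
  conj : m ∈ unip F (Fin.revPerm * v⁻¹)
  eq : x = q * m * (bar F v⁻¹)⁻¹

theorem UpperForm.inv_bar_mul {x n p : G F r} (h : UpperForm u x n p) :
    (bar F u)⁻¹ * x = n * p := by
  rw [h.eq]; group

theorem LowerForm.mul_bar {x q m : G F r} (h : LowerForm v x q m) :
    x * bar F v⁻¹ = q * m := by
  rw [h.eq]; group

/-- `U ū U` consists of the elements with an upper normal form. -/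
theorem exists_upperForm {a b : G F r} (ha : a ∈ unip F 1) (hb : b ∈ unip F 1) :
    ∃ n p, UpperForm u (a * bar F u * b) n p := by
  obtain ⟨l, hl, p, -, hl', hp, he⟩ := unip_factor (bar_conj_mem_unip u ha)
  refine ⟨l, p * b, hl, hl', mul_mem hp hb, ?_⟩
  rw [mul_assoc (bar F u), ← mul_assoc l, ← he]
  group

theorem UpperForm.exists_eq {x n p : G F r} (h : UpperForm u x n p) :
    ∃ a ∈ unip F 1, ∃ b ∈ unip F 1, x = a * bar F u * b := by
  refine ⟨bar F u * n * (bar F u)⁻¹, ?_, p, h.upper, ?_⟩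
  · simpa using bar_conj_inv_mem_unip u h.conj
  · rw [h.eq]; group

/-- The double coset `B⁻ v̂ B⁻` consists of the elements with a lower normal form. -/
theorem exists_lowerForm {a b : G F r} (ha : a ∈ borel F Fin.revPerm)
    (hb : b ∈ borel F Fin.revPerm) : ∃ q m, LowerForm v (a * (bar F v⁻¹)⁻¹ * b) q m := by
  obtain ⟨d, hd, n, hn, rfl⟩ := borel_levi' hb
  obtain ⟨l, -, m, hm, hl, hm', he⟩ := unip_factor (bar_conj_mem_unip v⁻¹ hn)
  refine ⟨a * ((bar F v⁻¹)⁻¹ * d * bar F v⁻¹) * l, m, mul_mem (mul_mem ha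
    (torus_le_borel (bar_conj_mem_torus _ hd))) hl.1, hm', hm, ?_⟩
  rw [mul_assoc _ l, ← he]
  group

theorem LowerForm.exists_eq {x q m : G F r} (h : LowerForm v x q m) :
    ∃ a ∈ borel F Fin.revPerm, ∃ b ∈ unip F Fin.revPerm, x = a * (bar F v⁻¹)⁻¹ * b := by
  refine ⟨q, h.lower, bar F v⁻¹ * m * (bar F v⁻¹)⁻¹, ?_, ?_⟩
  · simpa using bar_conj_inv_mem_unip v⁻¹ h.conj
  · rw [h.eq]; group

theorem permElt_eq_mul_bar_inv (v : Equiv.Perm (Fin (r + 1))) :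
    ∃ d ∈ torus F r, permElt F v = d * (bar F v⁻¹)⁻¹ := by
  obtain ⟨d, hd, he⟩ := bar_eq_permElt_mul (F := F) v⁻¹
  refine ⟨d, hd, ?_⟩
  rw [he, permElt_inv]
  group

theorem mem_lowerCell_iff {x : G F r} :
    x ∈ DoubleCoset.doubleCoset (permElt F v) (Bminus F r) (Bminus F r) ↔
      ∃ q m, LowerForm v x q m := by
  obtain ⟨d, hd, he⟩ := permElt_eq_mul_bar_inv (F := F) v
  rw [DoubleCoset.mem_doubleCoset]
  constructor
  · rintro ⟨a, ha, b, hb, rfl⟩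
    rw [he, ← mul_assoc a d]
    exact exists_lowerForm (mul_mem (mem_Bminus.mp ha) (torus_le_borel hd)) (mem_Bminus.mp hb)
  · rintro ⟨q, m, h⟩
    obtain ⟨a, ha, b, hb, rfl⟩ := h.exists_eq
    refine ⟨a * d⁻¹, mem_Bminus.mpr (mul_mem ha (inv_mem (torus_le_borel hd))), b,
      mem_Bminus.mpr hb.1, ?_⟩
    rw [he]; group

theorem mem_reducedCell_iff {x : G F r} :
    x ∈ reducedCell F u v ↔ (∃ n p, UpperForm u x n p) ∧ ∃ q m, LowerForm v x q m := by
  rw [reducedCell, Set.mem_inter_iff, mem_lowerCell_iff, DoubleCoset.mem_doubleCoset]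
  refine and_congr_left fun _ => ⟨?_, ?_⟩
  · rintro ⟨a, ha, b, hb, rfl⟩
    exact exists_upperForm ha hb
  · rintro ⟨n, p, h⟩
    obtain ⟨a, ha, b, hb, rfl⟩ := h.exists_eq
    exact ⟨a, ha, b, hb, rfl⟩

theorem LowerForm.torus_mul {x q m h : G F r} (hx : LowerForm v x q m) (hh : h ∈ torus F r) :
    LowerForm v (h * x) (h * q) m :=
  ⟨mul_mem (torus_le_borel hh) hx.lower, hx.upper, hx.conj, by rw [hx.eq]; group⟩

/-- `G^{u,v} = H L^{u,v}`. -/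
theorem mem_doubleCell_iff {g : G F r} :
    g ∈ doubleCell F u v ↔ ∃ h ∈ torus F r, ∃ x ∈ reducedCell F u v, g = h * x := by
  obtain ⟨d, hd, he⟩ := bar_eq_permElt_mul (F := F) u
  rw [doubleCell, Set.mem_inter_iff, mem_lowerCell_iff, DoubleCoset.mem_doubleCoset]
  constructor
  · rintro ⟨⟨a, ha, b, hb, hg⟩, q, m, hL⟩
    obtain ⟨d₂, hd₂, n₂, hn₂, he₂⟩ := borel_levi' 
      (mul_mem (inv_mem (torus_le_borel hd)) (mem_B.mp hb))
    obtain ⟨h, hh, n₁, hn₁, he₁⟩ := borel_levi' (mul_mem ha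
      (torus_le_borel (σ := 1) (bar_conj_inv_mem_torus u hd₂)))
    have hg' : g = h * (n₁ * bar F u * n₂) := by
      calc g = a * (permElt F u * d) * (d⁻¹ * b) := by rw [hg]; group
        _ = a * (bar F u * d₂ * (bar F u)⁻¹) * bar F u * n₂ := by rw [← he, he₂]; group
        _ = _ := by rw [he₁]; group
    refine ⟨h, hh, _, mem_reducedCell_iff.mpr ⟨exists_upperForm hn₁ hn₂, h⁻¹ * q, m, ?_⟩, hg'⟩
    rw [← inv_mul_eq_of_eq_mul hg']
    exact hL.torus_mul (inv_mem hh)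
  · rintro ⟨h, hh, x, hx, rfl⟩
    obtain ⟨⟨n, p, hU⟩, q, m, hL⟩ := mem_reducedCell_iff.mp hx
    refine ⟨?_, _, _, hL.torus_mul hh⟩
    obtain ⟨a, ha, b, hb, rfl⟩ := hU.exists_eq
    refine ⟨h * a, mul_mem (torus_le_borel (σ := 1) hh) ha.1, d * b,
      mul_mem (torus_le_borel (σ := 1) hd) hb.1, ?_⟩
    rw [he]; group

end Cells

/-! ### The twist and its inverse -/

section Twist

variable {F : Type*} [DivisionRing F] {r : ℕ} {u v : Equiv.Perm (Fin (r + 1))}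

theorem UpperForm.gauss {x n p h : G F r} (hx : UpperForm u x n p) (hh : h ∈ torus F r) :
    (bar F u)⁻¹ * (h * x) ∈ G0 F r ∧ gaussPlus ((bar F u)⁻¹ * (h * x)) = p ∧
      gaussZero ((bar F u)⁻¹ * (h * x)) = (bar F u)⁻¹ * h * bar F u := by
  have he : (bar F u)⁻¹ * (h * x) = (bar F u)⁻¹ * h * bar F u * n * p := by rw [hx.eq]; group
  have ht := bar_conj_mem_torus u hh
  obtain ⟨h1, -, h2, h3, h4⟩ :=
    gauss_mul (mul_mem (torus_le_borel ht) hx.lower.1) hx.upper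
  rw [he]
  refine ⟨h1, h2, ?_⟩
  ext i j
  by_cases hij : i = j
  · subst hij
    rw [h4, torus_mul_apply ht, hx.lower.2, mul_one]
  · rw [h3 i j hij, ht i j hij]

theorem torus_mul_reducedCell_injective {h h' x x' : G F r} (hh : h ∈ torus F r)
    (hh' : h' ∈ torus F r) (hx : x ∈ reducedCell F u v) (hx' : x' ∈ reducedCell F u v)
    (he : h * x = h' * x') : h = h' ∧ x = x' := by
  obtain ⟨⟨n, p, hU⟩, -⟩ := mem_reducedCell_iff.mp hx
  obtain ⟨⟨n', p', hU'⟩, -⟩ := mem_reducedCell_iff.mp hx'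
  have h1 := (hU.gauss hh).2.2
  rw [he, (hU'.gauss hh').2.2] at h1
  obtain rfl : h' = h := mul_left_cancel (mul_right_cancel h1)
  exact ⟨rfl, mul_left_cancel he⟩

theorem twist_mul {h x : G F r} (hh : h ∈ torus F r) (hx : x ∈ reducedCell F u v) :
    twist u v (h * x) = h * reducedTwist u v x := by
  have hex : ∃ k ∈ H F r, k⁻¹ * (h * x) ∈ reducedCell F u v := ⟨h, hh, by simpa using hx⟩
  have h1 := (torus_mul_reducedCell_injective (h := hex.choose) hex.choose_spec.1 hh
    hex.choose_spec.2 hx (mul_inv_cancel_left _ _))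
  rw [twist, dif_pos hex, h1.1, inv_mul_cancel_left]

/-- In terms of normal forms, `ψ^{u,v}(x) = J q⁻¹ x p⁻¹ J`. -/
theorem reducedTwist_eq {x n p q m : G F r} (hU : UpperForm u x n p) (hL : LowerForm v x q m) :
    reducedTwist u v x = J F r * q⁻¹ * x * p⁻¹ * J F r := by
  rw [reducedTwist, hL.mul_bar, hU.inv_bar_mul, (gauss_mul hL.lower hL.upper).2.1,
    (gauss_mul hU.lower.1 hU.upper).2.2.1]
  have hJ (y : G F r) : J F r * (J F r * y) = y := by rw [← mul_assoc, J_mul_J, one_mul]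
  simp only [iota, mul_inv_rev, inv_inv, J_inv, mul_assoc, hJ]

/-- The twist exchanges the two normal forms: the upper one of `x` yields the lower one of
`ψ^{u,v}(x)`, and conversely. -/
theorem reducedTwist_forms {x n p q m : G F r} (hU : UpperForm u x n p)
    (hL : LowerForm v x q m) :
    UpperForm v (reducedTwist u v x) ((bar F v)⁻¹ * (J F r * m * J F r) * bar F v)
      (J F r * p⁻¹ * J F r) ∧
    LowerForm u (reducedTwist u v x) (J F r * q⁻¹ * J F r)
      ((bar F u⁻¹)⁻¹ * (J F r * n * J F r) * bar F u⁻¹) := by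
  have hJ (y : G F r) : J F r * (J F r * y) = y := by rw [← mul_assoc, J_mul_J, one_mul]
  have hm := J_conj_mem_unip hL.upper
  have hm' := J_conj_mem_unip hL.conj
  have hn := J_conj_mem_unip hU.lower
  have hn' := J_conj_mem_unip hU.conj
  rw [reducedTwist_eq hU hL]
  refine ⟨⟨by simpa using bar_conj_mem_unip v hm, by simpa using bar_conj_mem_unip v hm',
    J_conj_mem_unip (inv_mem hU.upper), ?_⟩,
    ⟨mul_mem (mul_mem J_mem_borel (inv_mem hL.lower)) J_mem_borel, ?_, ?_, ?_⟩⟩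
  · have h1 : J F r * q⁻¹ * x = J F r * m * (bar F v⁻¹)⁻¹ := by rw [hL.eq]; group
    rw [h1, ← J_conj_bar v]
    simp only [mul_assoc, mul_inv_cancel_left]
  · simpa using bar_conj_mem_unip u⁻¹ hn'
  · exact bar_conj_mem_unip u⁻¹ hn
  · have h1 : J F r * q⁻¹ * x * p⁻¹ = J F r * q⁻¹ * (bar F u * n) := by rw [hU.eq]; group
    have h2 (y z : G F r) : y * ((bar F u⁻¹)⁻¹ * z * bar F u⁻¹) * (bar F u⁻¹)⁻¹ =
        y * ((bar F u⁻¹)⁻¹ * z) := by group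
    rw [h1, h2, ← J_conj_bar u]
    simp only [mul_assoc, hJ]

theorem reducedTwist_mem {x : G F r} (hx : x ∈ reducedCell F u v) :
    reducedTwist u v x ∈ reducedCell F v u := by
  obtain ⟨⟨n, p, hU⟩, q, m, hL⟩ := mem_reducedCell_iff.mp hx
  obtain ⟨h1, h2⟩ := reducedTwist_forms hU hL
  exact mem_reducedCell_iff.mpr ⟨⟨_, _, h1⟩, _, _, h2⟩

theorem reducedTwist_reducedTwist {x : G F r} (hx : x ∈ reducedCell F u v) :
    reducedTwist v u (reducedTwist u v x) = x := by
  obtain ⟨⟨n, p, hU⟩, q, m, hL⟩ := mem_reducedCell_iff.mp hx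
  obtain ⟨h1, h2⟩ := reducedTwist_forms hU hL
  have hJ (y : G F r) : J F r * (J F r * y) = y := by rw [← mul_assoc, J_mul_J, one_mul]
  rw [reducedTwist_eq h1 h2, reducedTwist_eq hU hL]
  simp only [mul_inv_rev, inv_inv, J_inv, mul_assoc, hJ]
  simp [J_mul_J]

theorem twist_mem {g : G F r} (hg : g ∈ doubleCell F u v) : twist u v g ∈ doubleCell F v u := by
  obtain ⟨h, hh, x, hx, rfl⟩ := mem_doubleCell_iff.mp hg
  exact mem_doubleCell_iff.mpr ⟨h, hh, _, reducedTwist_mem hx, twist_mul hh hx⟩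

theorem twist_twist {g : G F r} (hg : g ∈ doubleCell F u v) : twist v u (twist u v g) = g := by
  obtain ⟨h, hh, x, hx, rfl⟩ := mem_doubleCell_iff.mp hg
  rw [twist_mul hh hx, twist_mul hh (reducedTwist_mem hx), reducedTwist_reducedTwist hx]

theorem twist_formula {g : G F r} (hg : g ∈ doubleCell F u v) :
    twist u v g =
      (bar F u * gaussZero ((bar F u)⁻¹ * g) * (bar F u)⁻¹) * iota (gaussMinus (g * bar F v⁻¹)) *
        (iota g)⁻¹ * iota (gaussPlus ((bar F u)⁻¹ * g)) := by
  obtain ⟨h, hh, x, hx, rfl⟩ := mem_doubleCell_iff.mp hg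
  obtain ⟨⟨n, p, hU⟩, q, m, hL⟩ := mem_reducedCell_iff.mp hx
  have hL' := hL.torus_mul hh
  have hJ (y : G F r) : J F r * (J F r * y) = y := by rw [← mul_assoc, J_mul_J, one_mul]
  rw [twist_mul hh hx, reducedTwist_eq hU hL, (hU.gauss hh).2.1, (hU.gauss hh).2.2, hL'.mul_bar,
    (gauss_mul hL'.lower hL'.upper).2.1]
  simp only [iota, mul_inv_rev, inv_inv, J_inv, mul_assoc, hJ, mul_inv_cancel, mul_one,
    mul_inv_cancel_left, inv_mul_cancel_left]

end Twist

/-! ### Quasiminors and Gauss factorizations -/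

section Quasi

variable {R : Type*} [Ring R] {m n : Type*} [Fintype m] [Fintype n] [DecidableEq m]
  [DecidableEq n]

/-- If the rows `p ≠ i` of `A`, multiplied by `ρ p`, add up to row `i` away from column `j`, then
the quasideterminant is the difference in column `j`. -/
theorem quasidet_eq_of_row_combination {A : Matrix m n R} {i : m} {j : n}
    (h : QuasidetDefined A i j) (ρ : {p : m // p ≠ i} → R)
    (hρ : ∀ q : {q : n // q ≠ j}, A i q = ∑ p, ρ p * A p q) :
    quasidet A i j = A i j - ∑ p, ρ p * A p j := by
  have hinv : IsInverse (deleteRowCol A i j) (inverse (deleteRowCol A i j)) := by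
    have h' : ∃ N, IsInverse (deleteRowCol A i j) N := h
    rw [inverse, dif_pos h']
    exact h'.choose_spec
  have hrow : (fun q : {q : n // q ≠ j} => A i q) = ρ ᵥ* deleteRowCol A i j := funext hρ
  rw [quasidet, hrow, ← Matrix.dotProduct_mulVec, Matrix.mulVec_mulVec, hinv.1, Matrix.one_mulVec]
  rfl

end Quasi

section Minors

variable {F : Type*} [DivisionRing F] {r : ℕ}

theorem isInverse_of_eq_submatrix {l m n : Type*} [Fintype l] [Fintype m] [Fintype n]
    [DecidableEq l] [DecidableEq m] [DecidableEq n] {M : Matrix m n F} (e₁ : l ≃ m) (e₂ : l ≃ n)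
    {X Y : Matrix l l F} (h : M = X.submatrix e₁.symm e₂.symm) (hXY : X * Y = 1) :
    IsInverse M (Y.submatrix e₂.symm e₁.symm) := by
  subst h
  constructor
  · rw [Matrix.submatrix_mul_equiv, hXY, Matrix.submatrix_one_equiv]
  · rw [Matrix.submatrix_mul_equiv, mul_eq_one_comm.mp hXY, Matrix.submatrix_one_equiv]

/-- The bijection `a ↦ w(a)` from `{1, …, k - 1}` onto `w{1, …, k}` without `w(k)`. -/
def initialEquiv (w : Equiv.Perm (Fin (r + 1))) (k : Fin (r + 1)) :
    {a : Fin (r + 1) // a < k} ≃ {p : initialImage w k // p ≠ lastElt w k} where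
  toFun a := ⟨⟨w a, by simp [initialImage, a.2.le]⟩,
    fun e => a.2.ne (w.injective (congrArg Subtype.val e))⟩
  invFun p := ⟨w⁻¹ p.1.1, by
    obtain ⟨⟨p, hp⟩, hne⟩ := p
    simp only [initialImage, Finset.mem_map, Finset.mem_Iic] at hp
    obtain ⟨a, ha, rfl⟩ := hp
    refine lt_of_le_of_ne (by simpa using ha) fun e => hne (Subtype.ext ?_)
    simpa [lastElt] using congrArg w e⟩
  left_inv a := by simp
  right_inv p := by simp

theorem card_filter_initialImage (w : Equiv.Perm (Fin (r + 1))) (k : Fin (r + 1)) :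
    ((initialImage w k).filter fun a => w k < a).card =
      (Finset.univ.filter fun c => c < k ∧ w k < w c).card := by
  rw [← Finset.card_map w.toEmbedding (s := Finset.univ.filter fun c => c < k ∧ w k < w c)]
  congr 1
  ext a
  simp only [initialImage, Finset.mem_filter, Finset.mem_map, Finset.mem_Iic, Finset.mem_univ,
    true_and]
  constructor
  · rintro ⟨⟨c, hc, rfl⟩, h⟩
    exact ⟨c, ⟨lt_of_le_of_ne hc fun e => h.ne' (congrArg w e), h⟩, rfl⟩
  · rintro ⟨c, ⟨hc, h⟩, rfl⟩
    exact ⟨⟨c, hc.le, rfl⟩, h⟩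

/-- Leading blocks of a product are products of leading blocks if the left factor is lower
triangular. -/
theorem leading_mul_of_lower {X : G F r} (hX : X ∈ borel F Fin.revPerm) (Y : G F r)
    (k : Fin (r + 1)) :
    ((X * Y).val.submatrix Subtype.val Subtype.val :
        Matrix {a : Fin (r + 1) // a < k} {a : Fin (r + 1) // a < k} F) =
      X.val.submatrix Subtype.val Subtype.val * Y.val.submatrix Subtype.val Subtype.val := by
  ext a b
  simp only [Matrix.submatrix_apply, Units.val_mul, Matrix.mul_apply]
  rw [← Finset.sum_subtype (Finset.Iio k) (by simp) fun c => X.val a c * Y.val c b]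
  refine (Finset.sum_subset (Finset.subset_univ _) fun c _ hc => ?_).symm
  rw [hX a c (Fin.rev_lt_rev.mpr (a.2.trans_le (by simpa using hc))), zero_mul]

/-- Leading blocks of a product are products of leading blocks if the right factor is upper
triangular. -/
theorem leading_mul_of_upper (X : G F r) {Y : G F r} (hY : Y ∈ borel F 1) (k : Fin (r + 1)) :
    ((X * Y).val.submatrix Subtype.val Subtype.val :
        Matrix {a : Fin (r + 1) // a < k} {a : Fin (r + 1) // a < k} F) =
      X.val.submatrix Subtype.val Subtype.val * Y.val.submatrix Subtype.val Subtype.val := by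
  ext a b
  simp only [Matrix.submatrix_apply, Units.val_mul, Matrix.mul_apply]
  rw [← Finset.sum_subtype (Finset.Iio k) (by simp) fun c => X.val a c * Y.val c b]
  refine (Finset.sum_subset (Finset.subset_univ _) fun c _ hc => ?_).symm
  have h : Y.val c b = 0 := hY c b (b.2.trans_le (by simpa using hc))
  rw [h, mul_zero]

theorem leading_mul_inverse {q p : G F r} (hq : q ∈ borel F Fin.revPerm) (hp : p ∈ borel F 1)
    (k : Fin (r + 1)) :
    ((q * p).val.submatrix Subtype.val Subtype.val :
        Matrix {a : Fin (r + 1) // a < k} {a : Fin (r + 1) // a < k} F) *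
      ((p⁻¹).val.submatrix Subtype.val Subtype.val *
        (q⁻¹).val.submatrix Subtype.val Subtype.val) = 1 := by
  have h1 (g : G F r) (hg : g = 1) : (g.val.submatrix Subtype.val Subtype.val :
        Matrix {a : Fin (r + 1) // a < k} {a : Fin (r + 1) // a < k} F) = 1 := by
    rw [hg]; exact Matrix.submatrix_one _ Subtype.val_injective
  rw [leading_mul_of_lower hq, Matrix.mul_assoc, ← Matrix.mul_assoc (p.val.submatrix _ _),
    ← leading_mul_of_upper p (inv_mem hp), h1 _ (mul_inv_cancel p), Matrix.one_mul,
    ← leading_mul_of_lower hq, h1 _ (mul_inv_cancel q)]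

/-- `Δ^k_{w,w'}(y)` is the `k`-th diagonal entry of `[w̄⁻¹ y w̄']_-`. -/
theorem delta_eq_of_gauss {w w' : Equiv.Perm (Fin (r + 1))} {y q p : G F r}
    (hq : q ∈ borel F Fin.revPerm) (hp : p ∈ unip F 1)
    (he : (bar F w)⁻¹ * y * bar F w' = q * p) (k : Fin (r + 1)) :
    DeltaDefined k w w' y.val ∧ Delta k w w' y.val = q.val k k := by
  have hy : ∀ a b, y.val (w a) (w' b) = barSign F w a * (q * p).val a b * barSign F w' b := by
    intro a b
    rw [← he, bar_conj_apply]
    simp only [← mul_assoc]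
    rw [barSign_mul_self, one_mul, mul_assoc, barSign_mul_self, mul_one]
  have hdef : DeltaDefined k w w' y.val := by
    let D (w : Equiv.Perm (Fin (r + 1))) :
        Matrix {a : Fin (r + 1) // a < k} {a : Fin (r + 1) // a < k} F :=
      Matrix.diagonal fun a => barSign F w a
    have hD (w) : D w * D w = 1 := by
      simp only [D, Matrix.diagonal_mul_diagonal, barSign_mul_self, Matrix.diagonal_one]
    have hM : deleteRowCol (subMat y.val (initialImage w k) (initialImage w' k)) (lastElt w k)
        (lastElt w' k) = (D w * (q * p).val.submatrix Subtype.val Subtype.val * D w').submatrix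
          (initialEquiv w k).symm (initialEquiv w' k).symm := by
      ext a b
      obtain ⟨a, rfl⟩ := (initialEquiv w k).surjective a
      obtain ⟨b, rfl⟩ := (initialEquiv w' k).surjective b
      simp only [D, Matrix.submatrix_apply, Equiv.symm_apply_apply, Matrix.mul_diagonal,
        Matrix.diagonal_mul]
      exact hy a b
    refine ⟨_, isInverse_of_eq_submatrix (initialEquiv w k) (initialEquiv w' k) hM
      (Y := D w' * ((p⁻¹).val.submatrix Subtype.val Subtype.val *
        (q⁻¹).val.submatrix Subtype.val Subtype.val) * D w) ?_⟩
    rw [Matrix.mul_assoc (D w * _), ← Matrix.mul_assoc (D w'), ← Matrix.mul_assoc (D w'), hD,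
      Matrix.one_mul, ← Matrix.mul_assoc, Matrix.mul_assoc (D w), leading_mul_inverse hq hp.1,
      Matrix.mul_one, hD]
  refine ⟨hdef, ?_⟩
  -- Row `k` of `q⁻¹ (q p) = p`, multiplied by `q_{kk}`.
  have hrow : ∀ b, (q * p).val k b + ∑ c : {c // c < k},
      q.val k k * (q⁻¹).val k c * (q * p).val c b = q.val k k * p.val k b := by
    intro b
    have h1 : ∑ c, (q⁻¹).val k c * (q * p).val c b = p.val k b := by
      rw [← Matrix.mul_apply, ← Units.val_mul, inv_mul_cancel_left]
    rw [← h1, Finset.mul_sum, ← Finset.sum_subtype (Finset.Iio k) (by simp)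
      fun c => q.val k k * (q⁻¹).val k c * (q * p).val c b]
    have hkk : q.val k k * (q⁻¹).val k k = 1 := by
      rw [borel_diag_inv hq, mul_inv_cancel₀ (borel_diag_ne_zero hq k)]
    rw [← Finset.sum_subset (Finset.subset_univ (insert k (Finset.Iio k))),
      Finset.sum_insert (by simp), ← mul_assoc, hkk, one_mul]
    · simp only [mul_assoc]
    · intro c _ hc
      have hc' : k < c := by
        simp only [Finset.mem_insert, Finset.mem_Iio, not_or, not_lt] at hc
        exact lt_of_le_of_ne hc.2 (Ne.symm hc.1)
      rw [inv_mem hq k c (Fin.rev_lt_rev.mpr hc'), zero_mul, mul_zero]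
  let ρ : {a : initialImage w k // a ≠ lastElt w k} → F := fun a =>
    -(barSign F w k * (q.val k k * (q⁻¹).val k ((initialEquiv w k).symm a).1) *
      barSign F w ((initialEquiv w k).symm a).1)
  have hsum : ∀ b, y.val (w k) (w' b) - ∑ a, ρ a * y.val a.1.1 (w' b) =
      barSign F w k * (q.val k k * p.val k b) * barSign F w' b := by
    intro b
    rw [← hrow, hy, ← Equiv.sum_comp (initialEquiv w k), mul_add, add_mul, Finset.mul_sum,
      Finset.sum_mul, sub_eq_add_neg, ← Finset.sum_neg_distrib]
    congr 1
    refine Finset.sum_congr rfl fun c _ => ?_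
    have hc : ((initialEquiv w k) c).1.1 = w c := rfl
    simp only [ρ, Equiv.symm_apply_apply, hc, hy, neg_mul, neg_neg]
    simp only [mul_assoc]
    rw [← mul_assoc (barSign F w c.1) (barSign F w c.1), barSign_mul_self, one_mul]
  have hquasi := quasidet_eq_of_row_combination hdef ρ fun b => by
    obtain ⟨b, rfl⟩ := (initialEquiv w' k).surjective b
    have h1 := hsum b
    have hpb : p.val k b = 0 := hp.1 k b b.2
    rw [hpb, mul_zero, mul_zero, zero_mul, sub_eq_zero] at h1
    exact h1
  have hval : quasidet (subMat y.val (initialImage w k) (initialImage w' k)) (lastElt w k)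
      (lastElt w' k) = barSign F w k * (q.val k k * p.val k k) * barSign F w' k :=
    hquasi.trans (hsum k)
  have hsign : ((-1 : F) ^ (((initialImage w k).filter fun a => w k < a).card +
      ((initialImage w' k).filter fun a => w' k < a).card)) = barSign F w' k * barSign F w k := by
    rw [card_filter_initialImage, card_filter_initialImage, add_comm, pow_add]
    rfl
  change (-1 : F) ^ (((initialImage w k).filter fun a => w k < a).card +
      ((initialImage w' k).filter fun a => w' k < a).card) * _ = _
  rw [hsign, hval, hp.2, mul_one, mul_assoc, ← mul_assoc (barSign F w k), ← mul_assoc (barSign F w k),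
    barSign_mul_self, one_mul, ← barSign_mul_comm, ← mul_assoc, barSign_mul_self, one_mul]

end Minors

/-! ### Reduced words -/

section Words

variable {N r : ℕ}

theorem length_mul_le (u v : Equiv.Perm (Fin N)) : length (u * v) ≤ length u + length v := by
  rw [length, ← Finset.card_filter_add_card_filter_not fun p : Fin N × Fin N => v p.1 < v p.2]
  refine Nat.add_le_add ?_ ?_
  · refine Finset.card_le_card_of_injOn (fun p => (v p.1, v p.2)) ?_ ?_
    · rintro ⟨a, b⟩ hab
      simp only [inversions, Finset.mem_coe, Finset.mem_filter, Finset.mem_univ,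
        true_and] at hab ⊢
      exact ⟨hab.2, hab.1.2⟩
    · rintro ⟨a, b⟩ _ ⟨c, d⟩ _ hE
      simpa using hE
  · refine Finset.card_le_card ?_
    rintro ⟨a, b⟩ hab
    simp only [inversions, Finset.mem_filter, Finset.mem_univ, true_and] at hab ⊢
    exact ⟨hab.1.1, lt_of_le_of_ne (not_lt.mp hab.2) (v.injective.ne hab.1.1.ne')⟩

theorem length_inv (w : Equiv.Perm (Fin N)) : length w⁻¹ = length w := by
  refine Finset.card_bij' (fun p _ => (w⁻¹ p.2, w⁻¹ p.1)) (fun p _ => (w p.2, w p.1)) ?_ ?_ ?_ ?_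
  all_goals
    rintro ⟨a, b⟩ hab
    simp_all [inversions]

theorem length_one : length (1 : Equiv.Perm (Fin N)) = 0 :=
  Finset.card_eq_zero.mpr (Finset.filter_eq_empty_iff.mpr fun _ _ h => h.1.not_gt h.2)

theorem length_simpleRefl (i : Fin r) : length (simpleRefl i) = 1 := by
  have h : inversions (simpleRefl i) = {(i.castSucc, i.succ)} := by
    ext ⟨a, b⟩
    simp only [inversions, Finset.mem_filter, Finset.mem_univ, true_and, Finset.mem_singleton,
      Prod.mk.injEq, simpleRefl, Equiv.swap_apply_def, Fin.ext_iff, Fin.lt_def, Fin.val_castSucc,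
      Fin.val_succ]
    constructor
    · rintro ⟨h1, h2⟩
      split_ifs at h2 <;> (try simp only [Fin.val_castSucc, Fin.val_succ] at h2) <;> omega
    · rintro ⟨h1, h2⟩
      refine ⟨by omega, ?_⟩
      rw [if_neg (by omega), if_pos h2, if_pos h1]
      simp
  rw [length, h, Finset.card_singleton]

theorem simpleRefl_inv (i : Fin r) : (simpleRefl i)⁻¹ = simpleRefl i := Equiv.swap_inv _ _

/-- The product of the simple reflections of a word. -/
def wordPerm (l : List (Fin r)) : Equiv.Perm (Fin (r + 1)) := (l.map simpleRefl).prod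

theorem wordPerm_append (l l' : List (Fin r)) :
    wordPerm (l ++ l') = wordPerm l * wordPerm l' := by
  simp [wordPerm]

theorem length_wordPerm_le (l : List (Fin r)) : length (wordPerm l) ≤ l.length := by
  induction l with
  | nil => exact length_one.le
  | cons i l ih =>
    have h := length_mul_le (simpleRefl i) (wordPerm l)
    rw [length_simpleRefl] at h
    simp only [wordPerm, List.map_cons, List.prod_cons, List.length_cons] at h ih ⊢
    omega

/-- The word is a reduced word for its product. -/
def WordReduced (l : List (Fin r)) : Prop := length (wordPerm l) = l.length

theorem IsReducedWord.eq_and_reduced {l : List (Fin r)} {w : Equiv.Perm (Fin (r + 1))}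
    (h : IsReducedWord l w) : w = wordPerm l ∧ WordReduced l :=
  ⟨h.1.symm, by rw [WordReduced, wordPerm, h.1, h.2]⟩

theorem WordReduced.append {l l' : List (Fin r)} (h : WordReduced (l ++ l')) :
    WordReduced l ∧ WordReduced l' ∧
      length (wordPerm l * wordPerm l') = length (wordPerm l) + length (wordPerm l') := by
  rw [WordReduced, wordPerm_append, List.length_append] at h
  have h1 := length_mul_le (wordPerm l) (wordPerm l')
  have h2 := length_wordPerm_le l
  have h3 := length_wordPerm_le l'
  simp only [WordReduced]
  omega

theorem wordPerm_singleton (i : Fin r) : wordPerm [i] = simpleRefl i := by simp [wordPerm]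

theorem prod_map_reflPos (l : List (Letter r)) :
    (l.map Letter.reflPos).prod = wordPerm (l.filterMap Letter.pos?) := by
  induction l with
  | nil => rfl
  | cons a l ih => cases a <;> simp_all [Letter.reflPos, Letter.pos?, wordPerm, List.filterMap_cons]

theorem prod_reverse_map_reflNeg (l : List (Letter r)) :
    (l.reverse.map Letter.reflNeg).prod = (wordPerm (l.filterMap Letter.neg?))⁻¹ := by
  induction l with
  | nil => rfl
  | cons a l ih => cases a <;> simp_all [Letter.reflNeg, Letter.neg?, wordPerm, simpleRefl_inv, List.filterMap_cons]

end Words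

/-! ### The generators `x_i(t)` and `x_{-i}(t)` -/

section Generators

variable {F : Type*} [DivisionRing F] {r : ℕ}

theorem phi_mul_apply (i : Fin r) (A : Matrix.GeneralLinearGroup (Fin 2) F) (g : G F r)
    (a b : Fin (r + 1)) :
    (phi i A * g).val a b =
      if a = i.castSucc then A.val 0 0 * g.val i.castSucc b + A.val 0 1 * g.val i.succ b
      else if a = i.succ then A.val 1 0 * g.val i.castSucc b + A.val 1 1 * g.val i.succ b
      else g.val a b := by
  have hne : i.castSucc ≠ i.succ := Fin.castSucc_lt_succ.ne
  change ∑ c, phiMat i A.val a c * g.val c b = _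
  by_cases ha : a = i.castSucc ∨ a = i.succ
  · rw [Finset.sum_eq_add_of_mem i.castSucc i.succ (Finset.mem_univ _) (Finset.mem_univ _) hne]
    · rcases ha with rfl | rfl <;> simp [phiMat, hne.symm]
    · rintro c - ⟨h1, h2⟩
      rcases ha with rfl | rfl <;> simp [phiMat, h1, h2]
  · rw [not_or] at ha
    rw [Finset.sum_eq_single a]
    · simp [phiMat, ha.1, ha.2]
    · intro c _ hc
      simp [phiMat, ha.1, ha.2, hc.symm]
    · simp

theorem mul_phi_apply (i : Fin r) (A : Matrix.GeneralLinearGroup (Fin 2) F) (g : G F r)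
    (a b : Fin (r + 1)) :
    (g * phi i A).val a b =
      if b = i.castSucc then g.val a i.castSucc * A.val 0 0 + g.val a i.succ * A.val 1 0
      else if b = i.succ then g.val a i.castSucc * A.val 0 1 + g.val a i.succ * A.val 1 1
      else g.val a b := by
  have hne : i.castSucc ≠ i.succ := Fin.castSucc_lt_succ.ne
  change ∑ c, g.val a c * phiMat i A.val c b = _
  by_cases hb : b = i.castSucc ∨ b = i.succ
  · rw [Finset.sum_eq_add_of_mem i.castSucc i.succ (Finset.mem_univ _) (Finset.mem_univ _) hne]
    · rcases hb with rfl | rfl <;> simp [phiMat, hne.symm]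
    · rintro c - ⟨h1, h2⟩
      rcases hb with rfl | rfl <;> simp [phiMat, h1, h2]
  · rw [not_or] at hb
    rw [Finset.sum_eq_single b]
    · simp [phiMat, hb.1, hb.2]
    · intro c _ hc
      simp [phiMat, hb.1, hb.2, hc]
    · simp

/-- The one-parameter subgroup `x_i`, with the parameter `0` allowed; for `t ≠ 0`, `xPos i t` is
`xAdd i t` by definition. -/
def xAdd (i : Fin r) (z : F) : G F r :=
  phi i
    { val := !![1, z; 0, 1]
      inv := !![1, -z; 0, 1]
      val_inv := by ext a b; fin_cases a <;> fin_cases b <;> simp [Matrix.mul_apply]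
      inv_val := by ext a b; fin_cases a <;> fin_cases b <;> simp [Matrix.mul_apply] }

theorem xAdd_apply (i : Fin r) (z : F) (a b : Fin (r + 1)) :
    (xAdd i z).val a b = if a = b then 1 else if a = i.castSucc ∧ b = i.succ then z else 0 := by
  have h := mul_phi_apply i ⟨!![1, z; 0, 1], !![1, -z; 0, 1],
    by ext a b; fin_cases a <;> fin_cases b <;> simp [Matrix.mul_apply],
    by ext a b; fin_cases a <;> fin_cases b <;> simp [Matrix.mul_apply]⟩ 1 a b
  have hne : i.castSucc ≠ i.succ := Fin.castSucc_lt_succ.ne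
  rw [one_mul] at h
  refine h.trans ?_
  by_cases hb : b = i.castSucc
  · subst hb; simp [Matrix.one_apply, hne]
  by_cases hb' : b = i.succ
  · subst hb'
    by_cases ha : a = i.castSucc
    · subst ha; simp [hne, hne.symm]
    · simp [Matrix.one_apply, hne.symm, ha]
  · simp [Matrix.one_apply, hb, hb']

theorem xAdd_mem_unip {σ : Equiv.Perm (Fin (r + 1))} (i : Fin r) (z : F)
    (h : σ i.castSucc < σ i.succ) : xAdd i z ∈ unip F σ := by
  refine ⟨fun a b hab => ?_, fun a => by simp [xAdd_apply]⟩
  rw [xAdd_apply, if_neg fun e => hab.ne' (congrArg σ e), if_neg]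
  rintro ⟨rfl, rfl⟩
  exact h.not_gt hab

theorem xAdd_inv (i : Fin r) (z : F) : (xAdd i z)⁻¹ = xAdd i (-z) := by
  rw [xAdd, xAdd, ← map_inv]
  congr 1
  ext a b
  rfl

/-- This factorization shows that `x_{-i}(t) ∈ U s̄_i U`. -/
theorem xNeg_eq (i : Fin r) (t : Fˣ) :
    xNeg i t = xAdd i (t : F)⁻¹ * sBar F i * xAdd i (t : F) := by
  rw [xNeg, xAdd, xAdd, sBar, ← map_mul, ← map_mul]
  congr 1
  ext a b
  fin_cases a <;> fin_cases b <;> simp [Matrix.mul_apply, Fin.sum_univ_two]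

theorem xNeg_mem_borel (i : Fin r) (t : Fˣ) : xNeg i t ∈ borel F Fin.revPerm := by
  intro a b hab
  replace hab : a < b := Fin.rev_lt_rev.mp hab
  rw [← mul_one (xNeg i t), xNeg, phi_mul_apply, Units.val_one]
  have h1 : i.castSucc < i.succ := Fin.castSucc_lt_succ
  split_ifs with h h'
  · subst h
    simp [Matrix.one_apply_ne hab.ne]
  · subst h'
    simp [Matrix.one_apply_ne hab.ne, Matrix.one_apply_ne (h1.trans hab).ne]
  · exact Matrix.one_apply_ne hab.ne

theorem xNeg_apply_castSucc (i : Fin r) (t : Fˣ) :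
    (xNeg i t).val i.castSucc i.castSucc = (t : F)⁻¹ := by
  rw [← mul_one (xNeg i t), xNeg, phi_mul_apply, Units.val_one]
  have h1 : i.castSucc ≠ i.succ := Fin.castSucc_lt_succ.ne
  simp [h1.symm]

theorem xNeg_apply_succ (i : Fin r) (t : Fˣ) : (xNeg i t).val i.succ i.succ = t := by
  rw [← mul_one (xNeg i t), xNeg, phi_mul_apply, Units.val_one]
  have h1 : i.castSucc ≠ i.succ := Fin.castSucc_lt_succ.ne
  simp [h1, h1.symm]

theorem sBar_mul_xAdd (i : Fin r) (z : F) : sBar F i * xAdd i z =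
    phi i ⟨!![0, -1; 1, z], !![z, 1; -1, 0],
      by ext a b; fin_cases a <;> fin_cases b <;> simp [Matrix.mul_apply],
      by ext a b; fin_cases a <;> fin_cases b <;> simp [Matrix.mul_apply]⟩ := by
  rw [sBar, xAdd, ← map_mul]
  congr 1
  ext a b
  fin_cases a <;> fin_cases b <;> simp [Matrix.mul_apply, Fin.sum_univ_two]

/-- Multiplying `q ∈ B⁻` by `x_i(t)` on the left and renormalizing exchanges the diagonal entries
`i` and `i + 1`, up to factors `t` and `t⁻¹`. -/
theorem exists_lowerForm_xPos_mul (i : Fin r) (t : Fˣ) {q : G F r}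
    (hq : q ∈ borel F Fin.revPerm) :
    ∃ q' m', LowerForm (simpleRefl i) (xPos i t * q) q' m' ∧
      q'.val i.castSucc i.castSucc = t * q.val i.succ i.succ ∧
      q'.val i.succ i.succ = (t : F)⁻¹ * q.val i.castSucc i.castSucc := by
  have h1 : i.castSucc < i.succ := Fin.castSucc_lt_succ
  have hq0 : ∀ a b, a < b → q.val a b = 0 := mem_Bminus.mpr hq
  have ht := t.ne_zero
  have hd := borel_diag_ne_zero hq i.succ
  -- This `z` makes the entry of `x_i(t) q s̄_i x_i(z)` in row `i` and column `i + 1` vanish.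
  let z : F := (t * q.val i.succ i.succ)⁻¹ *
    (q.val i.castSucc i.castSucc + t * q.val i.succ i.castSucc)
  have hz : (t : F) * q.val i.succ i.succ * z =
      q.val i.castSucc i.castSucc + t * q.val i.succ i.castSucc :=
    mul_inv_cancel_left₀ (mul_ne_zero ht hd) _
  have hz' : q.val i.succ i.succ * z - q.val i.succ i.castSucc =
      (t : F)⁻¹ * q.val i.castSucc i.castSucc := by
    rw [eq_inv_mul_iff_mul_eq₀ ht, mul_sub, ← mul_assoc, hz, add_sub_cancel_right]
  have hval : ∀ a b, (xPos i t * q * (sBar F i * xAdd i z)).val a b =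
      if b = i.castSucc then (xPos i t * q).val a i.succ
      else if b = i.succ then (xPos i t * q).val a i.succ * z - (xPos i t * q).val a i.castSucc
      else (xPos i t * q).val a b := by
    intro a b
    rw [sBar_mul_xAdd, mul_phi_apply]
    simp [sub_eq_neg_add]
  have hval' : ∀ a b, (xPos i t * q).val a b =
      if a = i.castSucc then q.val i.castSucc b + t * q.val i.succ b else q.val a b := by
    intro a b
    rw [xPos, phi_mul_apply]
    by_cases ha : a = i.castSucc
    · simp [ha]
    · by_cases ha' : a = i.succ <;> simp [ha, ha']
  refine ⟨xPos i t * q * (sBar F i * xAdd i z), xAdd i (-z), ⟨?_, ?_, ?_, ?_⟩, ?_, ?_⟩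
  · refine mem_Bminus.mp fun a b hab => ?_
    rw [hval]
    split_ifs with hb hb'
    · subst hb
      rw [hval', if_neg hab.ne, hq0 _ _ (hab.trans h1)]
    · subst hb'
      rw [hval', hval']
      split_ifs with ha
      · rw [hq0 _ _ h1, zero_add, hz, sub_self]
      · have hab' : a < i.castSucc := lt_of_le_of_ne (Fin.le_castSucc_iff.mpr hab) ha
        rw [hq0 _ _ hab, hq0 _ _ hab', zero_mul, sub_zero]
    · rw [hval']
      split_ifs with ha
      · subst ha
        have hb2 : i.succ < b := lt_of_le_of_ne (Fin.castSucc_lt_iff_succ_le.mp hab) (Ne.symm hb')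
        rw [hq0 _ _ hab, hq0 _ _ hb2, mul_zero, add_zero]
      · exact hq0 _ _ hab
  · exact xAdd_mem_unip i _ h1
  · refine xAdd_mem_unip i _ (Fin.rev_lt_rev.mpr ?_)
    rw [simpleRefl_inv, simpleRefl, Equiv.swap_apply_left, Equiv.swap_apply_right]
    exact h1
  · rw [simpleRefl_inv, bar_simpleRefl, ← xAdd_inv]
    group
  · rw [hval, if_pos rfl, hval', if_pos rfl, hq0 _ _ h1, zero_add]
  · rw [hval, if_neg h1.ne', if_pos rfl, hval', hval', if_neg h1.ne', if_neg h1.ne', hz']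

end Generators

/-! ### Normal forms of products -/

section Products

variable {F : Type*} [DivisionRing F] {r : ℕ} {u w v v' : Equiv.Perm (Fin (r + 1))}

theorem UpperForm.unip_mul {x n p g : G F r} (hx : UpperForm u x n p) (hg : g ∈ unip F 1) :
    ∃ n' p', UpperForm u (g * x) n' p' := by
  obtain ⟨a, ha, b, hb, rfl⟩ := hx.exists_eq
  simpa only [mul_assoc] using exists_upperForm (u := u) (mul_mem hg ha) hb

theorem LowerForm.mul_borel {x q m g : G F r} (hx : LowerForm v x q m)
    (hg : g ∈ borel F Fin.revPerm) : ∃ q' m', LowerForm v (x * g) q' m' := by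
  obtain ⟨a, ha, b, hb, rfl⟩ := hx.exists_eq
  simpa only [mul_assoc] using exists_lowerForm (v := v) ha (mul_mem hb.1 hg)

/-- The upper normal form of a length-additive product: the factor `p` of `x` is absorbed by
`x'`, and the factor `n` is moved across `w̄`. -/
theorem UpperForm.mul {x x' n p n' p' : G F r} (hx : UpperForm u x n p)
    (hx' : UpperForm w (p * x') n' p') (hl : length (u * w) = length u + length w) :
    UpperForm (u * w) (x * x') ((bar F w)⁻¹ * n * bar F w * n') p' := by
  refine ⟨mul_mem (bar_conj_mem_unip w hx.conj) (unip_mul_left hl hx'.lower hx'.conj),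
    mul_mem (bar_conj_mem_unip_rev hl hx.lower hx.conj) hx'.lower, hx'.upper, ?_⟩
  rw [hx.eq, mul_assoc, hx'.eq, bar_mul u w hl]
  group

/-- The lower normal form of a length-additive product: the factor `q'` of `x'` is absorbed by
`x`, and the factor `m'` is moved across `bar(v⁻¹)`. -/
theorem LowerForm.mul {x x' q m q' m' : G F r} (hx : LowerForm v (x * q') q m)
    (hx' : LowerForm v' x' q' m') (hl : length (v * v') = length v + length v') :
    LowerForm (v * v') (x * x') q (m * ((bar F v⁻¹)⁻¹ * m' * bar F v⁻¹)) := by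
  have hl' : length (v'⁻¹ * v⁻¹) = length v'⁻¹ + length v⁻¹ := by
    rw [← mul_inv_rev, length_inv, length_inv, length_inv, hl, add_comm]
  refine ⟨hx.lower, mul_mem hx.upper (bar_conj_mem_unip_one hl' hx'.upper hx'.conj), ?_, ?_⟩
  · rw [mul_inv_rev]
    refine mul_mem (unip_rev_mul_left hl' hx.upper hx.conj) ?_
    rw [← mul_assoc Fin.revPerm]
    exact bar_conj_mem_unip v⁻¹ hx'.conj
  · have h1 := hx.mul_bar
    rw [hx'.eq, mul_inv_rev, bar_mul _ _ hl', ← mul_assoc q, ← h1]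
    group

/-- One step of the recursion for the diagonal part of `[x bar(v⁻¹)]_-`, for a negative letter:
`x_{-i}(t)` is lower triangular and goes into `q`. -/
theorem LowerForm.xNeg_mul {x q m : G F r} (hx : LowerForm v x q m) (i : Fin r) (t : Fˣ) :
    LowerForm v (xNeg i t * x) (xNeg i t * q) m :=
  ⟨mul_mem (xNeg_mem_borel i t) hx.lower, hx.upper, hx.conj, by rw [hx.eq]; group⟩

theorem J_conj_apply_self {g : G F r} (i : Fin (r + 1)) :
    (J F r * g * J F r).val i i = g.val i i := by
  have h : ((J F r).val i i) = (-1) ^ (i.val + 1) := by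
    rw [J, diag_apply_self]; push_cast; rfl
  rw [mul_torus_apply J_mem_torus, torus_mul_apply J_mem_torus, h,
    ((Commute.neg_one_left (g.val i i)).pow_left _).eq, mul_assoc, ← pow_add,
    Even.neg_one_pow ⟨_, rfl⟩, mul_one]

/-- If `x = h x₁ x₂` is a length-additive factorization of type `(u₁ u₂, v₁ v₂)`, then
`v̄₁⁻¹ ψ(x) bar(u₂⁻¹)` has a Gauss factorization whose diagonal part is, up to `h`, inverse to that
of `x₂ bar(v₂⁻¹)`. -/
theorem delta_twist_mul {u₁ u₂ v₁ v₂ : Equiv.Perm (Fin (r + 1))}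
    {h x₁ x₂ n₁ p₁ q₁ m₁ n₂ p₂ q₂ m₂ : G F r} (hh : h ∈ torus F r)
    (hU₁ : UpperForm u₁ x₁ n₁ p₁) (hU₂ : UpperForm u₂ x₂ n₂ p₂)
    (hL₁ : LowerForm v₁ x₁ q₁ m₁) (hL₂ : LowerForm v₂ x₂ q₂ m₂)
    (hu : length (u₁ * u₂) = length u₁ + length u₂)
    (hv : length (v₁ * v₂) = length v₁ + length v₂) (j : Fin (r + 1)) :
    DeltaDefined j v₁ u₂⁻¹ (twist (u₁ * u₂) (v₁ * v₂) (h * (x₁ * x₂))).val ∧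
      Delta j v₁ u₂⁻¹ (twist (u₁ * u₂) (v₁ * v₂) (h * (x₁ * x₂))).val =
        h.val (v₁ j) (v₁ j) * (q₂.val j j)⁻¹ := by
  obtain ⟨n', p', hU⟩ := hU₂.unip_mul hU₁.upper
  obtain ⟨q', m', hL⟩ := hL₁.mul_borel hL₂.lower
  have hx := mem_reducedCell_iff.mpr ⟨⟨_, _, hU₁.mul hU hu⟩, _, _, hL.mul hL₂ hv⟩
  -- The two outer factors of `v̄₁⁻¹ ψ(x₁ x₂) bar(u₂⁻¹) = J ν q₂⁻¹ μ J` lie in `U⁻` and `U`.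
  have hν : bar F v₁⁻¹ * m' * (bar F v₁⁻¹)⁻¹ ∈ unip F Fin.revPerm := by
    simpa using bar_conj_inv_mem_unip v₁⁻¹ hL.conj
  have hμ : p₁⁻¹ * (bar F u₂ * n' * (bar F u₂)⁻¹) ∈ unip F 1 :=
    mul_mem (inv_mem hU₁.upper) (by simpa using bar_conj_inv_mem_unip u₂ hU.conj)
  have hJ (y : G F r) : J F r * (J F r * y) = y := by rw [← mul_assoc, J_mul_J, one_mul]
  have hb := bar_conj_mem_torus v₁ hh
  have hq : bar F v₁⁻¹ * m' * (bar F v₁⁻¹)⁻¹ * q₂⁻¹ ∈ borel F Fin.revPerm :=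
    mul_mem hν.1 (inv_mem hL₂.lower)
  have hqJ := mul_mem (mul_mem (J_mem_borel (σ := Fin.revPerm)) hq) J_mem_borel
  have hJb (w : Equiv.Perm (Fin (r + 1))) : (bar F w)⁻¹ * J F r = J F r * bar F w⁻¹ := by
    have h1 : J F r * bar F w * J F r * bar F w⁻¹ = 1 := by rw [J_conj_bar, inv_mul_cancel]
    rw [inv_mul_eq_iff_eq_mul, ← mul_right_inj (J F r), J_mul_J, ← h1]
    simp only [mul_assoc]
  have he : (bar F v₁)⁻¹ * (h * (J F r * q'⁻¹ * (x₁ * x₂) * p'⁻¹ * J F r)) * bar F u₂⁻¹ =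
      ((bar F v₁)⁻¹ * h * bar F v₁ * (J F r * (bar F v₁⁻¹ * m' * (bar F v₁⁻¹)⁻¹ * q₂⁻¹) * J F r)) *
        (J F r * (p₁⁻¹ * (bar F u₂ * n' * (bar F u₂)⁻¹)) * J F r) := by
    have h1 : q'⁻¹ * x₁ = m' * (bar F v₁⁻¹)⁻¹ * q₂⁻¹ := by
      rw [eq_mul_inv_iff_mul_eq, mul_assoc, hL.eq]; group
    have h2 : x₂ * p'⁻¹ = p₁⁻¹ * (bar F u₂ * n') := by
      rw [eq_inv_mul_iff_mul_eq, ← mul_assoc, hU.eq]; group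
    calc _ = (bar F v₁)⁻¹ * h * bar F v₁ * ((bar F v₁)⁻¹ * J F r) * (q'⁻¹ * x₁) * (x₂ * p'⁻¹) *
          (J F r * bar F u₂⁻¹) := by group
      _ = _ := by rw [hJb v₁, ← hJb u₂, h1, h2]; simp only [mul_assoc, hJ]
  rw [twist_mul hh hx, reducedTwist_eq (hU₁.mul hU hu) (hL.mul hL₂ hv)]
  obtain ⟨h1, h2⟩ := delta_eq_of_gauss (mul_mem (torus_le_borel hb) hqJ) (J_conj_mem_unip hμ) he j
  refine ⟨h1, ?_⟩
  rw [h2, torus_mul_apply hb, bar_conj_apply_self, J_conj_apply_self,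
    borel_diag_mul hν.1 (inv_mem hL₂.lower), hν.2, one_mul, borel_diag_inv hL₂.lower]

end Products

/-! ### Factorizations along double reduced words -/

section Factorization

variable {F : Type*} [DivisionRing F] {r : ℕ}

/-- The product `x_{i_1}(t_1) ⋯ x_{i_m}(t_m)` over a list of letters with parameters. -/
def listProd (W : List (Letter r × Fˣ)) : G F r := (W.map fun a => a.1.elt a.2).prod

/-- The word in the negative letters. -/
def negWord (W : List (Letter r × Fˣ)) : List (Fin r) := (W.map Prod.fst).filterMap Letter.neg?

/-- The word in the positive letters. -/
def posWord (W : List (Letter r × Fˣ)) : List (Fin r) := (W.map Prod.fst).filterMap Letter.pos?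

theorem listProd_append (W W' : List (Letter r × Fˣ)) :
    listProd (W ++ W') = listProd W * listProd W' := by
  simp [listProd]

theorem listProd_cons (a : Letter r × Fˣ) (W : List (Letter r × Fˣ)) :
    listProd (a :: W) = a.1.elt a.2 * listProd W := by
  simp [listProd]

theorem negWord_append (W W' : List (Letter r × Fˣ)) :
    negWord (W ++ W') = negWord W ++ negWord W' := by
  simp [negWord]

theorem posWord_append (W W' : List (Letter r × Fˣ)) :
    posWord (W ++ W') = posWord W ++ posWord W' := by
  simp [posWord]

theorem upperForm_one : UpperForm 1 (1 : G F r) 1 1 :=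
  ⟨one_mem _, one_mem _, one_mem _, by rw [bar_one]; simp⟩

theorem lowerForm_one : LowerForm 1 (1 : G F r) 1 1 :=
  ⟨one_mem _, one_mem _, one_mem _, by rw [inv_one, bar_one]; simp⟩

theorem exists_upperForm_listProd (W : List (Letter r × Fˣ)) (h : WordReduced (negWord W)) :
    ∃ n p, UpperForm (wordPerm (negWord W)) (listProd W) n p := by
  induction W with
  | nil => exact ⟨1, 1, upperForm_one⟩
  | cons a W ih =>
    obtain ⟨a, t⟩ := a
    rw [listProd_cons]
    have h1 (z : F) (i : Fin r) : xAdd i z ∈ unip F 1 := xAdd_mem_unip i z Fin.castSucc_lt_succ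
    cases a with
    | pos i =>
      obtain ⟨n, p, hx⟩ := ih h
      exact hx.unip_mul (h1 t i)
    | neg i =>
      obtain ⟨-, h3, h4⟩ := WordReduced.append (l := [i]) (l' := negWord W) h
      obtain ⟨n, p, hx⟩ := ih h3
      have hs : ∃ n p, UpperForm (simpleRefl i) (xNeg i t) n p := by
        rw [xNeg_eq, ← bar_simpleRefl]
        exact exists_upperForm (h1 _ i) (h1 _ i)
      obtain ⟨n', p', hs⟩ := hs
      obtain ⟨n'', p'', hx'⟩ := hx.unip_mul hs.upper
      rw [wordPerm_singleton] at h4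
      exact ⟨_, _, hs.mul hx' h4⟩

/-- One step of the recursion for the diagonal part of `[x bar(v⁻¹)]_-`, for a positive letter. -/
theorem exists_lowerForm_pos_cons {W : List (Letter r × Fˣ)} {i : Fin r} {t : Fˣ}
    (h : WordReduced (posWord ((Letter.pos i, t) :: W))) {q m : G F r}
    (hx : LowerForm (wordPerm (posWord W)) (listProd W) q m) :
    ∃ q' m', LowerForm (wordPerm (posWord ((Letter.pos i, t) :: W)))
        (listProd ((Letter.pos i, t) :: W)) q' m' ∧
      q'.val i.castSucc i.castSucc = t * q.val i.succ i.succ ∧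
      q'.val i.succ i.succ = (t : F)⁻¹ * q.val i.castSucc i.castSucc := by
  obtain ⟨-, -, h4⟩ := WordReduced.append (l := [i]) (l' := posWord W) h
  rw [wordPerm_singleton] at h4
  obtain ⟨q', m', hq', h5⟩ := exists_lowerForm_xPos_mul i t hx.lower
  rw [listProd_cons]
  exact ⟨q', _, hq'.mul hx h4, h5⟩

theorem exists_lowerForm_listProd (W : List (Letter r × Fˣ)) (h : WordReduced (posWord W)) :
    ∃ q m, LowerForm (wordPerm (posWord W)) (listProd W) q m := by
  induction W with
  | nil => exact ⟨1, 1, lowerForm_one⟩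
  | cons a W ih =>
    obtain ⟨a, t⟩ := a
    cases a with
    | pos i =>
      obtain ⟨q, m, hx⟩ := ih (WordReduced.append (l := [i]) (l' := posWord W) h).2.1
      obtain ⟨q', m', h1, -⟩ := exists_lowerForm_pos_cons h hx
      exact ⟨q', m', h1⟩
    | neg i =>
      obtain ⟨q, m, hx⟩ := ih h
      rw [listProd_cons]
      exact ⟨_, _, hx.xNeg_mul i t⟩

/-- The quasiminors of the twist at the cut between `W₁` and `W₂`. -/
theorem delta_twist_listProd {W₁ W₂ : List (Letter r × Fˣ)} {h q m : G F r} (hh : h ∈ torus F r)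
    (hn : WordReduced (negWord (W₁ ++ W₂))) (hp : WordReduced (posWord (W₁ ++ W₂)))
    (hq : LowerForm (wordPerm (posWord W₂)) (listProd W₂) q m) (j : Fin (r + 1)) :
    DeltaDefined j (wordPerm (posWord W₁)) (wordPerm (negWord W₂))⁻¹
        (twist (wordPerm (negWord (W₁ ++ W₂))) (wordPerm (posWord (W₁ ++ W₂)))
          (h * listProd (W₁ ++ W₂))).val ∧
      Delta j (wordPerm (posWord W₁)) (wordPerm (negWord W₂))⁻¹
        (twist (wordPerm (negWord (W₁ ++ W₂))) (wordPerm (posWord (W₁ ++ W₂)))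
          (h * listProd (W₁ ++ W₂))).val =
        h.val (wordPerm (posWord W₁) j) (wordPerm (posWord W₁) j) * (q.val j j)⁻¹ := by
  rw [negWord_append] at hn ⊢
  rw [posWord_append] at hp ⊢
  obtain ⟨hn₁, hn₂, hn⟩ := hn.append
  obtain ⟨hp₁, hp₂, hp⟩ := hp.append
  obtain ⟨n₁, p₁, hU₁⟩ := exists_upperForm_listProd W₁ hn₁
  obtain ⟨n₂, p₂, hU₂⟩ := exists_upperForm_listProd W₂ hn₂
  obtain ⟨q₁, m₁, hL₁⟩ := exists_lowerForm_listProd W₁ hp₁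
  rw [wordPerm_append, wordPerm_append, listProd_append]
  exact delta_twist_mul hh hU₁ hU₂ hL₁ hq hn hp j

end Factorization

/-! ### The factorization parameters -/

section Parameters

variable {F : Type*} [DivisionRing F] {r m : ℕ} {w : Fin m → Letter r}

/-- The letters with their parameters, as a list. -/
def letterList (w : Fin m → Letter r) (t : Fin m → Fˣ) : List (Letter r × Fˣ) :=
  List.ofFn fun k => (w k, t k)

theorem map_fst_letterList (t : Fin m → Fˣ) : (letterList w t).map Prod.fst = List.ofFn w := by
  rw [letterList, List.map_ofFn]; rfl

theorem listProd_letterList (t : Fin m → Fˣ) : listProd (letterList w t) = productMap w t := by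
  rw [listProd, letterList, List.map_ofFn]; rfl

theorem vHead_ofFn (t : Fin m → Fˣ) (n : ℕ) :
    vHead (List.ofFn w) n = wordPerm (posWord ((letterList w t).take n)) := by
  rw [vHead, prod_map_reflPos, posWord, List.map_take, map_fst_letterList]

theorem uTail_ofFn (t : Fin m → Fˣ) (n : ℕ) :
    uTail (List.ofFn w) n = (wordPerm (negWord ((letterList w t).drop n)))⁻¹ := by
  rw [uTail, prod_reverse_map_reflNeg, negWord, List.map_drop, map_fst_letterList]

theorem drop_letterList (t : Fin m → Fˣ) (k : Fin m) :
    (letterList w t).drop k = (w k, t k) :: (letterList w t).drop (k + 1) := by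
  rw [List.drop_eq_getElem_cons (by simp [letterList])]
  simp [letterList]

theorem vLe_eq (k : Fin m) : vLe w k = vLt w k * (w k).reflPos := by
  rw [vLe, vLt, vHead, vHead, List.map_take, List.map_take, List.prod_take_succ _ _ (by simp)]
  simp

theorem uGe_eq (k : Fin m) : uGe w k = uGt w k * (w k).reflNeg := by
  rw [uGe, uGt, uTail, uTail, List.drop_eq_getElem_cons (by simp)]
  simp

variable {u v : Equiv.Perm (Fin (r + 1))}

theorem upperForm_productMap (hw : IsDoubleReducedWord (List.ofFn w) u v) (t : Fin m → Fˣ) :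
    ∃ n p, UpperForm u (productMap w t) n p := by
  obtain ⟨hu, hr⟩ := hw.1.eq_and_reduced
  rw [← map_fst_letterList t] at hu hr
  rw [← listProd_letterList, hu]
  exact exists_upperForm_listProd _ hr

theorem wordReduced_posWord_drop (hw : IsDoubleReducedWord (List.ofFn w) u v) (t : Fin m → Fˣ) (n : ℕ) :
    WordReduced (posWord ((letterList w t).drop n)) := by
  have hr := hw.2.eq_and_reduced.2
  rw [← map_fst_letterList t, ← List.take_append_drop n (letterList w t)] at hr
  change WordReduced (posWord _) at hr
  rw [posWord_append] at hr
  exact hr.append.2.1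

theorem delta_twist_productMap (hw : IsDoubleReducedWord (List.ofFn w) u v)
    (h : Fin (r + 1) → Fˣ) (t : Fin m → Fˣ) (n : ℕ) {q p : G F r}
    (hq : LowerForm (wordPerm (posWord ((letterList w t).drop n)))
      (listProd ((letterList w t).drop n)) q p) (j : Fin (r + 1)) :
    DeltaDefined j (vHead (List.ofFn w) n) (uTail (List.ofFn w) n)
        (twist u v (diag h * productMap w t)).val ∧
      Delta j (vHead (List.ofFn w) n) (uTail (List.ofFn w) n)
        (twist u v (diag h * productMap w t)).val =
        h (vHead (List.ofFn w) n j) * (q.val j j)⁻¹ := by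
  obtain ⟨hu, hr⟩ := hw.1.eq_and_reduced
  obtain ⟨hv, hr'⟩ := hw.2.eq_and_reduced
  rw [← map_fst_letterList t] at hu hr hv hr'
  have hW := (List.take_append_drop n (letterList w t)).symm
  have key := delta_twist_listProd (W₁ := (letterList w t).take n) (diag_mem_torus h)
    (by rw [← hW]; exact hr) (by rw [← hW]; exact hr') hq j
  rw [← hW, listProd_letterList, diag_apply_self] at key
  rw [vHead_ofFn t, uTail_ofFn t, hu, hv]
  exact key

theorem inv_ratio_left {a q t : F} (ha : a ≠ 0) (hq : q ≠ 0) :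
    t = (a * q⁻¹)⁻¹ * (a * (t⁻¹ * q)⁻¹) := by
  rw [mul_inv_rev, mul_inv_rev, inv_inv, inv_inv, mul_assoc, inv_mul_cancel_left₀ ha,
    mul_inv_cancel_left₀ hq]

theorem inv_ratio_right {a q t : F} (ha : a ≠ 0) (hq : q ≠ 0) :
    t = (a * (t * q)⁻¹)⁻¹ * (a * q⁻¹) := by
  rw [mul_inv_rev, inv_inv, mul_assoc, inv_mul_cancel_left₀ ha, mul_assoc, mul_inv_cancel₀ hq,
    mul_one]

theorem diag_eq_delta (hw : IsDoubleReducedWord (List.ofFn w) u v) (h : Fin (r + 1) → Fˣ)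
    (t : Fin m → Fˣ) (i : Fin (r + 1)) :
    DeltaDefined (u⁻¹ i) u 1 (diag h * productMap w t).val ∧
      (h i : F) = Delta (u⁻¹ i) u 1 (diag h * productMap w t).val := by
  obtain ⟨n, p, hU⟩ := upperForm_productMap hw t
  have ht := bar_conj_mem_torus u (diag_mem_torus h)
  have he : (bar F u)⁻¹ * (diag h * productMap w t) * bar F 1 =
      (bar F u)⁻¹ * diag h * bar F u * n * p := by
    rw [hU.eq, bar_one]; group
  obtain ⟨h1, h2⟩ :=
    delta_eq_of_gauss (mul_mem (torus_le_borel ht) hU.lower.1) hU.upper he (u⁻¹ i)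
  refine ⟨h1, ?_⟩
  rw [h2, torus_mul_apply ht, hU.lower.2, mul_one, bar_conj_apply_self, diag_apply_self]
  simp

/-- At a negative letter, the ratios at the cuts before and after the letter give the parameter. -/
theorem parameter_neg (hw : IsDoubleReducedWord (List.ofFn w) u v) (h : Fin (r + 1) → Fˣ)
    (t : Fin m → Fˣ) {y : G F r} (hy : y = twist u v (diag h * productMap w t)) {k : Fin m}
    {i : Fin r} (hk : w k = Letter.neg i) :
    (DeltaDefined i.castSucc (vLt w k) (uGt w k) y.val ∧
      DeltaDefined i.castSucc (vLt w k) (uGe w k) y.val ∧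
      Delta i.castSucc (vLt w k) (uGt w k) y.val ≠ 0 ∧
      (t k : F) = (Delta i.castSucc (vLt w k) (uGt w k) y.val)⁻¹ *
        Delta i.castSucc (vLt w k) (uGe w k) y.val) ∧
    (DeltaDefined i.succ (vLt w k) (uGe w k) y.val ∧
      DeltaDefined i.succ (vLt w k) (uGt w k) y.val ∧
      Delta i.succ (vLt w k) (uGe w k) y.val ≠ 0 ∧
      (t k : F) = (Delta i.succ (vLt w k) (uGe w k) y.val)⁻¹ *
        Delta i.succ (vLt w k) (uGt w k) y.val) := by
  obtain ⟨q, p, hq⟩ := exists_lowerForm_listProd _ (wordReduced_posWord_drop hw t (k + 1))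
  have hq' : LowerForm (wordPerm (posWord ((letterList w t).drop k)))
      (listProd ((letterList w t).drop k)) (xNeg i (t k) * q) p := by
    rw [drop_letterList, listProd_cons, hk]
    exact hq.xNeg_mul i (t k)
  have hv : vLe w k = vLt w k := by rw [vLe_eq, hk, Letter.reflPos, mul_one]
  have hGt (j) := delta_twist_productMap hw h t _ hq j
  have hGe (j) := delta_twist_productMap hw h t _ hq' j
  rw [← hy] at hGt hGe
  change ∀ j, DeltaDefined j (vLe w k) (uGt w k) y.val ∧
    Delta j (vLe w k) (uGt w k) y.val = h (vLe w k j) * (q.val j j)⁻¹ at hGt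
  change ∀ j, DeltaDefined j (vLt w k) (uGe w k) y.val ∧
    Delta j (vLt w k) (uGe w k) y.val = h (vLt w k j) * ((xNeg i (t k) * q).val j j)⁻¹ at hGe
  rw [hv] at hGt
  have hq0 := borel_diag_ne_zero hq.lower
  have ht := (t k).ne_zero
  have hh (j : Fin (r + 1)) := (h j).ne_zero
  refine ⟨⟨(hGt _).1, (hGe _).1, ?_, ?_⟩, (hGe _).1, (hGt _).1, ?_, ?_⟩
  · rw [(hGt _).2]
    exact mul_ne_zero (hh _) (inv_ne_zero (hq0 _))
  · rw [(hGt _).2, (hGe _).2, borel_diag_mul (xNeg_mem_borel _ _) hq.lower, xNeg_apply_castSucc]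
    exact inv_ratio_left (hh _) (hq0 _)
  · rw [(hGe _).2]
    exact mul_ne_zero (hh _) (inv_ne_zero (borel_diag_ne_zero hq'.lower _))
  · rw [(hGt _).2, (hGe _).2, borel_diag_mul (xNeg_mem_borel _ _) hq.lower, xNeg_apply_succ]
    exact inv_ratio_right (hh _) (hq0 _)

/-- At a positive letter, the permutations `v_{<k}` and `v_{≤k}` differ by `s_i`, which matches
the exchange of the diagonal entries `i` and `i + 1`. -/
theorem parameter_pos (hw : IsDoubleReducedWord (List.ofFn w) u v) (h : Fin (r + 1) → Fˣ)
    (t : Fin m → Fˣ) {y : G F r} (hy : y = twist u v (diag h * productMap w t)) {k : Fin m}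
    {i : Fin r} (hk : w k = Letter.pos i) :
    (DeltaDefined i.castSucc (vLe w k) (uGt w k) y.val ∧
      DeltaDefined i.succ (vLt w k) (uGt w k) y.val ∧
      Delta i.castSucc (vLe w k) (uGt w k) y.val ≠ 0 ∧
      (t k : F) = (Delta i.castSucc (vLe w k) (uGt w k) y.val)⁻¹ *
        Delta i.succ (vLt w k) (uGt w k) y.val) ∧
    (DeltaDefined i.castSucc (vLt w k) (uGt w k) y.val ∧
      DeltaDefined i.succ (vLe w k) (uGt w k) y.val ∧
      Delta i.castSucc (vLt w k) (uGt w k) y.val ≠ 0 ∧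
      (t k : F) = (Delta i.castSucc (vLt w k) (uGt w k) y.val)⁻¹ *
        Delta i.succ (vLe w k) (uGt w k) y.val) := by
  obtain ⟨q, p, hq⟩ := exists_lowerForm_listProd _ (wordReduced_posWord_drop hw t (k + 1))
  have hred := wordReduced_posWord_drop hw t k
  rw [drop_letterList, hk] at hred
  obtain ⟨q', p', hq', hc, hs⟩ := exists_lowerForm_pos_cons hred hq
  rw [← hk, ← drop_letterList] at hq'
  have hu : uGe w k = uGt w k := by rw [uGe_eq, hk, Letter.reflNeg, mul_one]
  have hvc : vLe w k i.castSucc = vLt w k i.succ := by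
    rw [vLe_eq, hk, Letter.reflPos, Equiv.Perm.mul_apply, simpleRefl, Equiv.swap_apply_left]
  have hvs : vLe w k i.succ = vLt w k i.castSucc := by
    rw [vLe_eq, hk, Letter.reflPos, Equiv.Perm.mul_apply, simpleRefl, Equiv.swap_apply_right]
  have hLe (j) := delta_twist_productMap hw h t _ hq j
  have hLt (j) := delta_twist_productMap hw h t _ hq' j
  rw [← hy] at hLe hLt
  change ∀ j, DeltaDefined j (vLe w k) (uGt w k) y.val ∧
    Delta j (vLe w k) (uGt w k) y.val = h (vLe w k j) * (q.val j j)⁻¹ at hLe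
  change ∀ j, DeltaDefined j (vLt w k) (uGe w k) y.val ∧
    Delta j (vLt w k) (uGe w k) y.val = h (vLt w k j) * (q'.val j j)⁻¹ at hLt
  rw [hu] at hLt
  have hq0 := borel_diag_ne_zero hq.lower
  have hh (j : Fin (r + 1)) := (h j).ne_zero
  refine ⟨⟨(hLe _).1, (hLt _).1, ?_, ?_⟩, (hLt _).1, (hLe _).1, ?_, ?_⟩
  · rw [(hLe _).2]
    exact mul_ne_zero (hh _) (inv_ne_zero (hq0 _))
  · rw [(hLe _).2, (hLt _).2, hvc, hs]
    exact inv_ratio_left (hh _) (hq0 _)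
  · rw [(hLt _).2]
    exact mul_ne_zero (hh _) (inv_ne_zero (borel_diag_ne_zero hq'.lower _))
  · rw [(hLe _).2, (hLt _).2, hvs, hc]
    exact inv_ratio_right (hh _) (hq0 _)

end Parameters
end DoubleBruhat

theorem mainTheorem3 {F : Type*} [DivisionRing F] {r : ℕ} (u v : Equiv.Perm (Fin (r + 1))) :
    -- the twist is well defined: its Gauss factorizations exist, and `G^{u,v} = H × L^{u,v}`
    (∀ g ∈ doubleCell F u v,
      (bar F u)⁻¹ * g ∈ G0 F r ∧
      g * bar F v⁻¹ ∈ G0 F r) ∧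
    Set.BijOn (fun p : G F r × G F r => p.1 * p.2)
      (H F r ×ˢ reducedCell F u v) (doubleCell F u v) ∧
    -- it extends the twist on `L^{u,v}` and is left `H`-equivariant
    (∀ h ∈ H F r, ∀ x ∈ reducedCell F u v,
      twist u v (h * x) = h * reducedTwist u v x) ∧
    (∀ h ∈ H F r, ∀ g ∈ doubleCell F u v,
      twist u v (h * g) = h * twist u v g) ∧
    -- explicit formula
    (∀ g ∈ doubleCell F u v,
      twist u v g =
        (bar F u * gaussZero ((bar F u)⁻¹ * g) *
            (bar F u)⁻¹) *
          iota (gaussMinus (g * bar F v⁻¹)) *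
          (iota g)⁻¹ *
          iota (gaussPlus ((bar F u)⁻¹ * g))) ∧
    -- it is an isomorphism `G^{u,v} → G^{v,u}` with inverse `ψ^{v,u}`
    Set.BijOn (twist u v)
      (doubleCell F u v) (doubleCell F v u) ∧
    Set.InvOn (twist v u) (twist u v)
      (doubleCell F u v) (doubleCell F v u) ∧
    -- the factorization parameters
    (∀ (m : ℕ) (w : Fin m → Letter r),
      IsDoubleReducedWord (List.ofFn w) u v →
      ∀ (h : Fin (r + 1) → Fˣ) (t : Fin m → Fˣ) (x y : G F r),
        x ∈ doubleCell F u v →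
        x = diag h * productMap w t →
        y = twist u v x →
        (∀ i : Fin (r + 1),
          DeltaDefined (u⁻¹ i) u 1 x.val ∧
          (h i : F) = Delta (u⁻¹ i) u 1 x.val) ∧
        (∀ (k : Fin m) (i : Fin r), w k = Letter.neg i →
          (DeltaDefined i.castSucc (vLt w k) (uGt w k)
              y.val ∧
            DeltaDefined i.castSucc (vLt w k) (uGe w k)
              y.val ∧
            Delta i.castSucc (vLt w k) (uGt w k)
              y.val ≠ 0 ∧
            (t k : F) =
              (Delta i.castSucc (vLt w k) (uGt w k)
                y.val)⁻¹ *
              Delta i.castSucc (vLt w k) (uGe w k)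
                y.val) ∧
          (DeltaDefined i.succ (vLt w k) (uGe w k)
              y.val ∧
            DeltaDefined i.succ (vLt w k) (uGt w k)
              y.val ∧
            Delta i.succ (vLt w k) (uGe w k)
              y.val ≠ 0 ∧
            (t k : F) =
              (Delta i.succ (vLt w k) (uGe w k)
                y.val)⁻¹ *
              Delta i.succ (vLt w k) (uGt w k)
                y.val)) ∧
        (∀ (k : Fin m) (i : Fin r), w k = Letter.pos i →
          (DeltaDefined i.castSucc (vLe w k) (uGt w k)
              y.val ∧
            DeltaDefined i.succ (vLt w k) (uGt w k)
              y.val ∧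
            Delta i.castSucc (vLe w k) (uGt w k)
              y.val ≠ 0 ∧
            (t k : F) =
              (Delta i.castSucc (vLe w k) (uGt w k)
                y.val)⁻¹ *
              Delta i.succ (vLt w k) (uGt w k)
                y.val) ∧
          (DeltaDefined i.castSucc (vLt w k) (uGt w k)
              y.val ∧
            DeltaDefined i.succ (vLe w k) (uGt w k)
              y.val ∧
            Delta i.castSucc (vLt w k) (uGt w k)
              y.val ≠ 0 ∧
            (t k : F) =
              (Delta i.castSucc (vLt w k) (uGt w k)
                y.val)⁻¹ *
              Delta i.succ (vLe w k) (uGt w k)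
                y.val))) := by
  refine ⟨fun g hg => ?_, ⟨?_, ?_, ?_⟩, fun h hh x hx => twist_mul hh hx, fun h hh g hg => ?_,
    fun g hg => twist_formula hg, ?_, ⟨fun g hg => twist_twist hg, fun g hg => twist_twist hg⟩,
    ?_⟩
  · obtain ⟨h, hh, x, hx, rfl⟩ := mem_doubleCell_iff.mp hg
    obtain ⟨⟨n, p, hU⟩, q, m, hL⟩ := mem_reducedCell_iff.mp hx
    refine ⟨(hU.gauss hh).1, ?_⟩
    have hL' := hL.torus_mul hh
    rw [hL'.mul_bar]
    exact (gauss_mul hL'.lower hL'.upper).1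
  · rintro ⟨h, x⟩ ⟨hh, hx⟩
    exact mem_doubleCell_iff.mpr ⟨h, hh, x, hx, rfl⟩
  · rintro ⟨h, x⟩ ⟨hh, hx⟩ ⟨h', x'⟩ ⟨hh', hx'⟩ he
    obtain ⟨h1, h2⟩ := torus_mul_reducedCell_injective hh hh' hx hx' he
    exact Prod.ext h1 h2
  · intro g hg
    obtain ⟨h, hh, x, hx, rfl⟩ := mem_doubleCell_iff.mp hg
    exact ⟨(h, x), ⟨hh, hx⟩, rfl⟩
  · obtain ⟨h', hh', x, hx, rfl⟩ := mem_doubleCell_iff.mp hg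
    rw [← mul_assoc, twist_mul (mul_mem (mem_H.mp hh) hh') hx, twist_mul hh' hx, mul_assoc]
  · exact Set.InvOn.bijOn ⟨fun g hg => twist_twist hg, fun g hg => twist_twist hg⟩
      (fun g hg => twist_mem hg) (fun g hg => twist_mem hg)
  · rintro m w hw h t x y - rfl hy
    exact ⟨diag_eq_delta hw h t, fun k i hk => parameter_neg hw h t hy hk,
      fun k i hk => parameter_pos hw h t hy hk⟩
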